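/- **Setting.** Let $E=\mathbb R^d$, let $k:E\times E\to[0,1]$ be a kernel, $n\in\mathbb N$ and $R\in\mathbb R$. A *hash family* is a collection $\mathcal H$ of functions on $E$ with a probability law $\nu$ (all collision events $\{h(x)=h(y)\}$ measurable); its collision probability is $p(x,y)=\mathbb P_{h\sim\nu}[h(x)=h(y)]$. For a finite nonempty set $Q\subset E$, a query $q\in E$ and $h\sim\nu$ let $H(q)=\{y\in Q: h(y)=h(q)\}$ and let $I$ be a uniformly random element of $H(q)$ (independent randomness). The *hashing-based estimator* (HBE) is $Z_h(q)=\frac1{|Q|}\frac{k(q,I)}{p(q,I)}|H(q)|$, and $Z_h(q)=0$ if $H(q)=\emptyset$. Put $\mu_Q(q)=\frac1{|Q|}\sum_{y\in Q}k(q,y)$. For a function $V$ that is nonnegative and non-increasing on $(0,1]$ and for which $\mu^2V(\mu)$ is non-decreasing on $(0,1]$, the HBE is *$V$-bounded* if $\mathbb E[Z_h(q)]=\mu_Q(q)$ and $\mathbb E[Z_h(q)^2]\le\mu_Q(q)^2\,V(\mu_Q(q))$ for all $Q$ with $1\le|Q|\le n$ and all $q$ with $\operatorname{diam}(Q\cup\{q\})\le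 R$. It has *complexity* $T$ (an integer $T\ge1$) if sampling $h$ and forming its hash table on $m$ points takes time and space at most $Tm$, and evaluating the estimator (returning $I$ and $Z_h(q)$) takes time at most $T$. **Model.** Algorithms are programs of a randomized real RAM: arrays of naturals and of reals, unit-cost reads, writes, comparisons, additions and truncated subtractions of naturals, field operations on reals, conversion of naturals to reals, and evaluations of $V$; no rounding of reals to integers. The points are accessed only by the two HBE operations, with the costs above and fresh independent randomness in each. The input is $n,z,\varepsilon,\tau$. Space is the number of memory cells used (input included) plus $Tm$ for each hash table on $m$ points. **Theorem.** There are a program and constants $C,c$ such that, for all $d,n,R,k$, every $V$-bounded HBE for $k$ (as above) of complexity $T$, every dataset $P=\{x_1,\dots,x_n\}\subset\mathbb R^d$ of $n$ distinct points with $\operatorname{diam}P\le R$, every $z\in\mathbb R^n$ with $z\ge0$ and $\|z\|_1=1$, and all $\varepsilon,\tau\in(0,1]$, the following holds with $K=(k(x_i,x_j))_{i,j\le n}$ and $y=Kz$. The program always halts, after time at most $$C\,\Big(\log\frac{2n}{\varepsilon\tau}\Big)^{c}\cdot\frac1{\varepsilon^2}\max\{1,V(\varepsilon\tau)\}\cdot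 nT=\tilde O\Big(\frac1{\varepsilon^2}V(\varepsilon\tau)\cdot nT\Big)$$ (the last form when $V(\varepsilon\tau)\ge1$) and using space at most the same bound, and with probability at least $1-1/n$ its output $\hat y\in\mathbb R^n$ satisfies $$|\hat y_i-y_i|\le3\varepsilon\tau+\varepsilon|y_i|\quad\text{for all }i\in\{1,\dots,n\},$$ and $$\|\hat y-y\|_p\le\varepsilon\big(3\tau n^{1/p}+\|y\|_p\big)\quad\text{for all real }p\ge1.$$ -/

import Mathlib

/-!
Hashing-based estimators and a randomized real RAM with access to such an estimator.
-/

namespace HBE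

open MeasureTheory

universe u v w

/-! ## Hash families and hashing-based estimators -/

/-- A family of hash functions on `E` together with a probability law on it. -/
structure HashFamily (E : Type w) where
  /-- the (index set of the) collection of hash functions -/
  Fn : Type u
  [meas : MeasurableSpace Fn]
  /-- the distribution from which a hash function is sampled -/
  law : Measure Fn
  [prob : IsProbabilityMeasure law]
  /-- the hash values -/
  Bucket : Type v
  hash : Fn → E → Bucket
  measurableSet_collision : ∀ x y : E, MeasurableSet {h | hash h x = hash h y}

attribute [instance] HashFamily.meas HashFamily.prob

namespace HashFamily

variable {E : Type w} (F : HashFamily.{u, v, w} E) {ι : Type*}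

/-- The collision probability `p(x, y)` of two points. -/
noncomputable def collisionProb (x y : E) : ℝ :=
  F.law.real {h | F.hash h x = F.hash h y}

open Classical in
/-- The cell `H(q)`: the elements of the dataset (a list `S` of labels, the point with label `j`
being `pt j`) that have the same hash value as the query `q`. -/
noncomputable def cell (pt : ι → E) (S : List ι) (h : F.Fn) (q : E) : List ι :=
  S.filter fun j => F.hash h (pt j) = F.hash h q

/-- The random element `I(q)` of the cell `H(q)`, and `none` if the cell is empty: for `r` uniform
in `[0, 1]`, the entry at position `⌊r · |H(q)|⌋` is uniform in `H(q)`
(`r = 1` is a null event). -/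
noncomputable def draw (pt : ι → E) (S : List ι) (h : F.Fn) (r : unitInterval) (q : E) :
    Option ι :=
  (F.cell pt S h q)[⌊(r : ℝ) * (F.cell pt S h q).length⌋₊]?

/-- The hashing-based estimator `Z_h(q) = (1 / |S|) · k(q, I) / p(q, I) · |H(q)|` with
`I = I(q)`, and `0` if the cell is empty. -/
noncomputable def estimate (k : E → E → ℝ) (pt : ι → E) (S : List ι) (h : F.Fn)
    (r : unitInterval) (q : E) : ℝ :=
  (F.draw pt S h r q).elim 0 fun j =>
    k q (pt j) / F.collisionProb q (pt j) * ((F.cell pt S h q).length / S.length)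

/-- The law of an infinite sequence of independent pairs (hash function drawn from the law of
the family, uniform number in `[0, 1]`). -/
noncomputable def tapeLaw : Measure (ℕ → F.Fn × unitInterval) :=
  Measure.infinitePi fun _ => F.law.prod (volume : Measure unitInterval)

end HashFamily

/-- The kernel density `μ(q) = (1 / |Q|) ∑_{y ∈ Q} k(q, y)` of a dataset. -/
noncomputable def density {E : Type w} (k : E → E → ℝ) (Q : List E) (q : E) : ℝ :=
  (Q.map (k q)).sum / Q.length

/-- The hashing-based estimator that the family `F` gives for the kernel `k` is unbiased and
`V`-bounded, for all datasets `Q` of at most `n` distinct points and all queries `q` such that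
`Q ∪ {q}` has diameter at most `R`. -/
structure VBounded {E : Type w} [PseudoMetricSpace E] (F : HashFamily.{u, v, w} E)
    (k : E → E → ℝ) (V : ℝ → ℝ) (R : ℝ) (n : ℕ) : Prop where
  nonneg : ∀ μ ∈ Set.Ioc (0 : ℝ) 1, 0 ≤ V μ
  antitone : AntitoneOn V (Set.Ioc 0 1)
  monotone : MonotoneOn (fun μ => μ ^ 2 * V μ) (Set.Ioc 0 1)
  unbiased : ∀ Q : List E, Q ≠ [] → Q.Nodup → Q.length ≤ n → ∀ q : E,
    Metric.diam (insert q {y | y ∈ Q}) ≤ R →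
      ∫ ω, F.estimate k id Q ω.1 ω.2 q ∂(F.law.prod (volume : Measure unitInterval))
        = density k Q q
  second_moment : ∀ Q : List E, Q ≠ [] → Q.Nodup → Q.length ≤ n → ∀ q : E,
    Metric.diam (insert q {y | y ∈ Q}) ≤ R →
      ∫ ω, F.estimate k id Q ω.1 ω.2 q ^ 2 ∂(F.law.prod (volume : Measure unitInterval))
        ≤ density k Q q ^ 2 * V (density k Q q)

/-! ## The machine

A random access machine whose memory consists of arrays of natural numbers and arrays of real
numbers. Arithmetic and comparisons of numbers, reads, writes and evaluations of the function `V`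
take unit time. There is no rounding of reals to integers. The dataset is accessed
only through the hashing-based estimator: forming the hash table of a freshly sampled hash function
on `m` points takes time and space `T · m`, and evaluating the estimator at a query takes time `T`. -/

/-- Expressions with values in `ℕ`. -/
inductive NExp where
  | lit (c : ℕ)
  /-- entry of an array of naturals -/
  | get (a : ℕ) (i : NExp)
  | add (e f : NExp)
  /-- truncated subtraction -/
  | sub (e f : NExp)

/-- Expressions with values in `ℝ`. -/
inductive RExp where
  | lit (c : ℚ)
  /-- entry of an array of reals -/
  | get (a : ℕ) (i : NExp)
  | ofNat (e : NExp)
  | add (e f : RExp)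
  | sub (e f : RExp)
  | mul (e f : RExp)
  | div (e f : RExp)
  /-- the value of the function `V` -/
  | bound (e : RExp)

/-- Tests. -/
inductive Test where
  | natLt (e f : NExp)
  | realLt (e f : RExp)
  | realLe (e f : RExp)

/-- Programs. -/
inductive Cmd where
  | skip
  /-- write into entry `i` of the array `a` of naturals -/
  | setNat (a : ℕ) (i : NExp) (e : NExp)
  /-- write into entry `i` of the array `a` of reals -/
  | setReal (a : ℕ) (i : NExp) (e : RExp)
  | seq (p q : Cmd)
  | ite (b : Test) (p q : Cmd)
  | loop (b : Test) (p : Cmd)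
  /-- sample a hash function and form its hash table on the points whose labels are the first `m`
  entries of the array `a` of naturals; the tables are numbered `0, 1, 2, …` -/
  | build (a : ℕ) (m : NExp)
  /-- evaluate the estimator of the table with number `t` at the point with label `q`; the label
  `I` is written into entry `0` of the array `a` of naturals (the number `n` of points stands for
  an empty cell), and the value `Z` into entry `0` of the array `b` of reals -/
  | query (t q : NExp) (a b : ℕ)

/-- What a program runs on: a hash family, a kernel, the function `V`, the complexity `T` of the
estimator and the `n` points of the dataset. -/
structure Env (E : Type w) (n : ℕ) where
  fam : HashFamily.{u, v, w} E
  ker : E → E → ℝ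
  bound : ℝ → ℝ
  cost : ℕ
  pt : Fin n → E

/-- Configurations of the machine. -/
structure State {E : Type w} {n : ℕ} (M : Env.{u, v, w} E n) where
  natMem : ℕ → ℕ → ℕ
  realMem : ℕ → ℕ → ℝ
  /-- the hash tables formed so far: hash function and labels of the points -/
  tables : List (M.fam.Fn × List (Fin n))
  /-- how many entries of the random tape have been used -/
  draws : ℕ
  /-- time elapsed -/
  time : ℕ
  /-- memory cells in use (array, index) -/
  natCells : Finset (ℕ × ℕ)
  realCells : Finset (ℕ × ℕ)

namespace NExp

variable {E : Type w} {n : ℕ} {M : Env.{u, v, w} E n}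

def eval (s : State M) : NExp → ℕ
  | lit c => c
  | get a i => s.natMem a (i.eval s)
  | add e f => e.eval s + f.eval s
  | sub e f => e.eval s - f.eval s

/-- The time needed to evaluate an expression. -/
def size : NExp → ℕ
  | lit _ => 1
  | get _ i => i.size + 1
  | add e f => e.size + f.size + 1
  | sub e f => e.size + f.size + 1

end NExp

namespace RExp

variable {E : Type w} {n : ℕ} {M : Env.{u, v, w} E n}

noncomputable def eval (s : State M) : RExp → ℝ
  | lit c => c
  | get a i => s.realMem a (i.eval s)
  | ofNat e => (e.eval s : ℝ)
  | add e f => e.eval s + f.eval s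
  | sub e f => e.eval s - f.eval s
  | mul e f => e.eval s * f.eval s
  | div e f => e.eval s / f.eval s
  | bound e => M.bound (e.eval s)

/-- The time needed to evaluate an expression. -/
def size : RExp → ℕ
  | lit _ => 1
  | get _ i => i.size + 1
  | ofNat e => e.size + 1
  | add e f => e.size + f.size + 1
  | sub e f => e.size + f.size + 1
  | mul e f => e.size + f.size + 1
  | div e f => e.size + f.size + 1
  | bound e => e.size + 1

end RExp

namespace Test

variable {E : Type w} {n : ℕ} {M : Env.{u, v, w} E n}

def Holds (s : State M) : Test → Prop
  | natLt e f => e.eval s < f.eval s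
  | realLt e f => e.eval s < f.eval s
  | realLe e f => e.eval s ≤ f.eval s

/-- The time needed for a test. -/
def size : Test → ℕ
  | natLt e f => e.size + f.size + 1
  | realLt e f => e.size + f.size + 1
  | realLe e f => e.size + f.size + 1

end Test

namespace State

variable {E : Type w} {n : ℕ} {M : Env.{u, v, w} E n}

/-- Let `c` units of time elapse. -/
def tick (s : State M) (c : ℕ) : State M := { s with time := s.time + c }

def writeNat (s : State M) (a i val : ℕ) : State M :=
  { s with
    natMem := Function.update s.natMem a (Function.update (s.natMem a) i val)
    natCells := insert (a, i) s.natCells }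

noncomputable def writeReal (s : State M) (a i : ℕ) (val : ℝ) : State M :=
  { s with
    realMem := Function.update s.realMem a (Function.update (s.realMem a) i val)
    realCells := insert (a, i) s.realCells }

/-- Append the hash table of `h` on the points with labels `S`; one entry of the tape is used. -/
def addTable (s : State M) (h : M.fam.Fn) (S : List (Fin n)) : State M :=
  { s with tables := s.tables ++ [(h, S)], draws := s.draws + 1 }

/-- Store the outcome of an evaluation of the estimator; one entry of the tape is used. -/
noncomputable def answer (s : State M) (a b : ℕ) (I : Option (Fin n)) (Z : ℝ) : State M :=
  { (s.writeNat a 0 (I.elim n Fin.val)).writeReal b 0 Z with draws := s.draws + 1 }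

/-- The space in use: memory cells, and `T · m` for every hash table on `m` points. Nothing is
ever freed, so that the space at the end is the peak. -/
def space (s : State M) : ℕ :=
  s.natCells.card + s.realCells.card + (s.tables.map fun t => M.cost * t.2.length).sum

end State

/-- `Exec M ω p s s'`: with random tape `ω`, the program `p` started in configuration `s` halts in
configuration `s'`. -/
inductive Exec {E : Type w} {n : ℕ} (M : Env.{u, v, w} E n) (ω : ℕ → M.fam.Fn × unitInterval) :
    Cmd → State M → State M → Prop where
  | skip (s : State M) : Exec M ω .skip s (s.tick 1)
  | setNat (s : State M) (a : ℕ) (i e : NExp) :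
      Exec M ω (.setNat a i e) s
        ((s.writeNat a (i.eval s) (e.eval s)).tick (i.size + e.size + 1))
  | setReal (s : State M) (a : ℕ) (i : NExp) (e : RExp) :
      Exec M ω (.setReal a i e) s
        ((s.writeReal a (i.eval s) (e.eval s)).tick (i.size + e.size + 1))
  | seq {p q : Cmd} {s s₁ s₂ : State M} (hp : Exec M ω p s s₁) (hq : Exec M ω q s₁ s₂) :
      Exec M ω (.seq p q) s s₂
  | iteTrue {b : Test} {p q : Cmd} {s s₁ : State M} (hb : b.Holds s)
      (hp : Exec M ω p (s.tick b.size) s₁) : Exec M ω (.ite b p q) s s₁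
  | iteFalse {b : Test} {p q : Cmd} {s s₁ : State M} (hb : ¬ b.Holds s)
      (hq : Exec M ω q (s.tick b.size) s₁) : Exec M ω (.ite b p q) s s₁
  | loopTrue {b : Test} {p : Cmd} {s s₁ s₂ : State M} (hb : b.Holds s)
      (hp : Exec M ω p (s.tick b.size) s₁) (hl : Exec M ω (.loop b p) s₁ s₂) :
      Exec M ω (.loop b p) s s₂
  | loopFalse {b : Test} {p : Cmd} {s : State M} (hb : ¬ b.Holds s) :
      Exec M ω (.loop b p) s (s.tick b.size)
  | build (s : State M) (a : ℕ) (m : NExp) (S : List (Fin n))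
      (hS : S.map Fin.val = (List.range (m.eval s)).map (s.natMem a)) :
      Exec M ω (.build a m) s
        ((s.addTable (ω s.draws).1 S).tick (m.size + 1 + M.cost * S.length))
  | query (s : State M) (t q : NExp) (a b : ℕ) (h : M.fam.Fn) (S : List (Fin n)) (i : Fin n)
      (ht : s.tables[t.eval s]? = some (h, S)) (hi : (i : ℕ) = q.eval s) :
      Exec M ω (.query t q a b) s
        ((s.answer a b (M.fam.draw M.pt S h (ω s.draws).2 (M.pt i))
          (M.fam.estimate M.ker M.pt S h (ω s.draws).2 (M.pt i))).tick
            (t.size + q.size + 1 + M.cost))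

/-- The machine is deterministic once the random tape is given. -/
theorem Exec.unique {E : Type w} {n : ℕ} {M : Env.{u, v, w} E n}
    {ω : ℕ → M.fam.Fn × unitInterval} {p : Cmd} {s s₁ s₂ : State M}
    (h₁ : Exec M ω p s s₁) (h₂ : Exec M ω p s s₂) : s₁ = s₂ := by
  induction h₁ generalizing s₂ with
  | skip s => cases h₂; rfl
  | setNat => cases h₂; rfl
  | setReal => cases h₂; rfl
  | seq _ _ ih₁ ih₂ =>
    cases h₂ with
    | seq hp hq => obtain rfl := ih₁ hp; exact ih₂ hq
  | iteTrue hb _ ih =>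
    cases h₂ with
    | iteTrue _ hp => exact ih hp
    | iteFalse hb' _ => exact absurd hb hb'
  | iteFalse hb _ ih =>
    cases h₂ with
    | iteTrue hb' _ => exact absurd hb' hb
    | iteFalse _ hp => exact ih hp
  | loopTrue hb _ _ ih₁ ih₂ =>
    cases h₂ with
    | loopTrue _ hp hl => obtain rfl := ih₁ hp; exact ih₂ hl
    | loopFalse hb' => exact absurd hb hb'
  | loopFalse hb =>
    cases h₂ with
    | loopTrue hb' _ _ => exact absurd hb' hb
    | loopFalse _ => rfl
  | build s a m S hS =>
    cases h₂ with
    | build _ _ _ S' hS' =>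
      obtain rfl : S = S' := Fin.val_injective.list_map (hS.trans hS'.symm)
      rfl
  | query s t q a b h S i ht hi =>
    cases h₂ with
    | query _ _ _ _ _ h' S' i' ht' hi' =>
      obtain rfl : i = i' := Fin.ext (hi.trans hi'.symm)
      obtain ⟨rfl, rfl⟩ := Prod.mk.inj (Option.some.inj (ht.symm.trans ht'))
      rfl

/-- The initial configuration on input `n`, `z`, `ε`, `τ`: the number `n` is entry `0` of array `0`
of naturals, the vector `z` is array `0` of reals, and `ε`, `τ` are the entries `0`, `1` of array
`1` of reals. All other cells hold `0`. -/
noncomputable def initState {E : Type w} {n : ℕ} (M : Env.{u, v, w} E n) (z : Fin n → ℝ)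
    (ε τ : ℝ) : State M where
  natMem a i := if a = 0 ∧ i = 0 then n else 0
  realMem a i :=
    if a = 0 then (if h : i < n then z ⟨i, h⟩ else 0)
    else if a = 1 ∧ i = 0 then ε
    else if a = 1 ∧ i = 1 then τ
    else 0
  tables := []
  draws := 0
  time := 0
  natCells := {(0, 0)}
  realCells := (Finset.range n).image (fun i => (0, i)) ∪ {(1, 0), (1, 1)}

/-- The output vector, read from array `2` of reals. -/
def output {E : Type w} {n : ℕ} {M : Env.{u, v, w} E n} (s : State M) : Fin n → ℝ :=
  fun i => s.realMem 2 i

/-- The `ℓ_p` norm of a vector. -/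
noncomputable def lpNorm {n : ℕ} (p : ℝ) (y : Fin n → ℝ) : ℝ :=
  (∑ i, |y i| ^ p) ^ (1 / p)

end HBE

/-!
Write the weights in binary, `z j = ∑ b, 2 ^ (-b) * z j b`, and put `t = ε * τ`. The points whose
digit at place `2 ^ (-b)` is `1` form a level `S b` of equal weights, so that `y i` is the sum over
`b` of `2 ^ (-b) * |S b|` times the kernel density of `S b` at `x i`. A repetition replaces every
density by the mean of `N = ⌈16 * (1 + V t) / ε ^ 2⌉` estimates from fresh hash tables of `S b`.

As `V` decreases and `μ ^ 2 * V μ` increases, one estimate of a density `μ` has variance at most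
`(μ ^ 2 + t ^ 2) * V t`. A repetition therefore has variance at most `(y i + t) ^ 2 * V t / N`,
and by Chebyshev's inequality it errs by more than `ε * (y i + t)` with probability at most
`1 / 16`. The upper median of `2 * L` independent repetitions errs as much only if half of them do,
which has probability at most `2 ^ (2 * L) * 16 ^ (-L) = 2 ^ (-2 * L)`. For `n ≤ 2 ^ L` this
leaves `1 / n` after a union bound over the `n` points, and once `n * 2 ^ (-(L - 1)) ≤ t` the
digits beyond the first `L` may be ignored, because together they contribute at most `t` to `y i`.

Space needs no separate analysis: every cell and every table is paid for by the time spent on it.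
-/

namespace HBE

open MeasureTheory ProbabilityTheory

universe u v w

section Machine

variable {E : Type w} {n : ℕ} {M : Env.{u, v, w} E n} {ω : ℕ → M.fam.Fn × unitInterval}

namespace State

@[simp] theorem natMem_tick (s : State M) (c : ℕ) : (s.tick c).natMem = s.natMem := rfl

@[simp] theorem realMem_tick (s : State M) (c : ℕ) : (s.tick c).realMem = s.realMem := rfl

@[simp] theorem tables_tick (s : State M) (c : ℕ) : (s.tick c).tables = s.tables := rfl

@[simp] theorem draws_tick (s : State M) (c : ℕ) : (s.tick c).draws = s.draws := rfl

@[simp] theorem time_tick (s : State M) (c : ℕ) : (s.tick c).time = s.time + c := rfl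

@[simp] theorem natMem_writeNat (s : State M) (a i x a' i' : ℕ) :
    (s.writeNat a i x).natMem a' i' = if a' = a ∧ i' = i then x else s.natMem a' i' := by
  rcases eq_or_ne a' a with rfl | h
  · simp [writeNat, Function.update_apply]
  · simp [writeNat, h]

@[simp] theorem realMem_writeNat (s : State M) (a i x : ℕ) :
    (s.writeNat a i x).realMem = s.realMem := rfl

@[simp] theorem tables_writeNat (s : State M) (a i x : ℕ) :
    (s.writeNat a i x).tables = s.tables := rfl

@[simp] theorem draws_writeNat (s : State M) (a i x : ℕ) :
    (s.writeNat a i x).draws = s.draws := rfl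

@[simp] theorem time_writeNat (s : State M) (a i x : ℕ) :
    (s.writeNat a i x).time = s.time := rfl

@[simp] theorem realMem_writeReal (s : State M) (a i : ℕ) (x : ℝ) (a' i' : ℕ) :
    (s.writeReal a i x).realMem a' i' = if a' = a ∧ i' = i then x else s.realMem a' i' := by
  rcases eq_or_ne a' a with rfl | h
  · simp [writeReal, Function.update_apply]
  · simp [writeReal, h]

@[simp] theorem natMem_writeReal (s : State M) (a i : ℕ) (x : ℝ) :
    (s.writeReal a i x).natMem = s.natMem := rfl

@[simp] theorem tables_writeReal (s : State M) (a i : ℕ) (x : ℝ) :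
    (s.writeReal a i x).tables = s.tables := rfl

@[simp] theorem draws_writeReal (s : State M) (a i : ℕ) (x : ℝ) :
    (s.writeReal a i x).draws = s.draws := rfl

@[simp] theorem time_writeReal (s : State M) (a i : ℕ) (x : ℝ) :
    (s.writeReal a i x).time = s.time := rfl

@[simp] theorem natMem_addTable (s : State M) (h : M.fam.Fn) (S : List (Fin n)) :
    (s.addTable h S).natMem = s.natMem := rfl

@[simp] theorem realMem_addTable (s : State M) (h : M.fam.Fn) (S : List (Fin n)) :
    (s.addTable h S).realMem = s.realMem := rfl

@[simp] theorem tables_addTable (s : State M) (h : M.fam.Fn) (S : List (Fin n)) :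
    (s.addTable h S).tables = s.tables ++ [(h, S)] := rfl

@[simp] theorem draws_addTable (s : State M) (h : M.fam.Fn) (S : List (Fin n)) :
    (s.addTable h S).draws = s.draws + 1 := rfl

@[simp] theorem time_addTable (s : State M) (h : M.fam.Fn) (S : List (Fin n)) :
    (s.addTable h S).time = s.time := rfl

@[simp] theorem natMem_answer (s : State M) (a b : ℕ) (I : Option (Fin n)) (Z : ℝ) (a' i' : ℕ) :
    (s.answer a b I Z).natMem a' i' =
      if a' = a ∧ i' = 0 then I.elim n Fin.val else s.natMem a' i' :=
  natMem_writeNat s a 0 _ a' i'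

@[simp] theorem realMem_answer (s : State M) (a b : ℕ) (I : Option (Fin n)) (Z : ℝ) (a' i' : ℕ) :
    (s.answer a b I Z).realMem a' i' = if a' = b ∧ i' = 0 then Z else s.realMem a' i' :=
  realMem_writeReal (s.writeNat a 0 _) b 0 Z a' i'

@[simp] theorem tables_answer (s : State M) (a b : ℕ) (I : Option (Fin n)) (Z : ℝ) :
    (s.answer a b I Z).tables = s.tables := rfl

@[simp] theorem draws_answer (s : State M) (a b : ℕ) (I : Option (Fin n)) (Z : ℝ) :
    (s.answer a b I Z).draws = s.draws + 1 := rfl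

@[simp] theorem time_answer (s : State M) (a b : ℕ) (I : Option (Fin n)) (Z : ℝ) :
    (s.answer a b I Z).time = s.time := rfl

end State

namespace Cmd

/-- Whether a program contains an instruction that writes into the array `a` of naturals. -/
@[simp] def writesNat (a : ℕ) : Cmd → Bool
  | setNat a' _ _ => a == a'
  | query _ _ a' _ => a == a'
  | seq p q => p.writesNat a || q.writesNat a
  | ite _ p q => p.writesNat a || q.writesNat a
  | loop _ p => p.writesNat a
  | _ => false

/-- Whether a program contains an instruction that writes into the array `a` of reals. -/
@[simp] def writesReal (a : ℕ) : Cmd → Bool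
  | setReal a' _ _ => a == a'
  | query _ _ _ a' => a == a'
  | seq p q => p.writesReal a || q.writesReal a
  | ite _ p q => p.writesReal a || q.writesReal a
  | loop _ p => p.writesReal a
  | _ => false

/-- Whether a program contains an instruction that reads the random tape. -/
@[simp] def usesTape : Cmd → Bool
  | build _ _ => true
  | query _ _ _ _ => true
  | seq p q => p.usesTape || q.usesTape
  | ite _ p q => p.usesTape || q.usesTape
  | loop _ p => p.usesTape
  | _ => false

end Cmd

/-- The two configurations agree outside the part of the machine that the program may modify. -/
structure Frame (p : Cmd) (s s' : State M) : Prop where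
  nat : ∀ a, p.writesNat a = false → ∀ i, s'.natMem a i = s.natMem a i
  real : ∀ a, p.writesReal a = false → ∀ i, s'.realMem a i = s.realMem a i
  tables : p.usesTape = false → s'.tables = s.tables
  draws : p.usesTape = false → s'.draws = s.draws

namespace Frame

variable {p q : Cmd} {s s₁ s₂ : State M}

theorem refl (p : Cmd) (s : State M) : Frame p s s :=
  ⟨fun _ _ _ => rfl, fun _ _ _ => rfl, fun _ => rfl, fun _ => rfl⟩

theorem trans (h : Frame p s s₁) (h' : Frame p s₁ s₂) : Frame p s s₂ :=
  ⟨fun a ha i => (h'.nat a ha i).trans (h.nat a ha i),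
    fun a ha i => (h'.real a ha i).trans (h.real a ha i),
    fun hp => (h'.tables hp).trans (h.tables hp), fun hp => (h'.draws hp).trans (h.draws hp)⟩

theorem mono (h : Frame p s s₁) (hnat : ∀ a, q.writesNat a = false → p.writesNat a = false)
    (hreal : ∀ a, q.writesReal a = false → p.writesReal a = false)
    (htape : q.usesTape = false → p.usesTape = false) : Frame q s s₁ :=
  ⟨fun a ha => h.nat a (hnat a ha), fun a ha => h.real a (hreal a ha),
    fun hq => h.tables (htape hq), fun hq => h.draws (htape hq)⟩

theorem of_tick {c : ℕ} (h : Frame p (s.tick c) s₁) : Frame p s s₁ := ⟨h.1, h.2, h.3, h.4⟩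

theorem tick {c : ℕ} (h : Frame p s s₁) : Frame p s (s₁.tick c) := ⟨h.1, h.2, h.3, h.4⟩

end Frame

theorem Exec.frame {p : Cmd} {s s' : State M} (h : Exec M ω p s s') : Frame p s s' := by
  induction h with
  | skip s => exact (Frame.refl _ s).tick
  | setNat s a i e => constructor <;> simp +contextual
  | setReal s a i e => constructor <;> simp +contextual
  | seq _ _ ih₁ ih₂ =>
    exact (ih₁.mono (by simp +contextual) (by simp +contextual) (by simp +contextual)).trans
      (ih₂.mono (by simp) (by simp) (by simp))
  | iteTrue _ _ ih =>
    exact ih.of_tick.mono (by simp +contextual) (by simp +contextual) (by simp +contextual)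
  | iteFalse _ _ ih => exact ih.of_tick.mono (by simp) (by simp) (by simp)
  | loopTrue _ _ _ ih₁ ih₂ =>
    exact (ih₁.of_tick.mono (fun _ => id) (fun _ => id) id : Frame (.loop _ _) _ _).trans ih₂
  | loopFalse _ => exact (Frame.refl _ _).tick
  | build => constructor <;> simp
  | query => constructor <;> simp +contextual

/-- Every unit of space is paid for by the time spent to claim it. -/
theorem Exec.space_le {p : Cmd} {s s' : State M} (h : Exec M ω p s s') :
    s'.space + s.time ≤ s.space + s'.time := by
  induction h with
  | skip s => simp [State.space, State.tick]
  | setNat s a i e =>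
    have := Finset.card_insert_le (a, i.eval s) s.natCells
    simp only [State.space, State.tick, State.writeNat]
    omega
  | setReal s a i e =>
    have := Finset.card_insert_le (a, i.eval s) s.realCells
    simp only [State.space, State.tick, State.writeReal]
    omega
  | seq _ _ ih₁ ih₂ => omega
  | iteTrue _ _ ih | iteFalse _ _ ih =>
    simp only [State.space, State.tick] at *
    omega
  | loopTrue _ _ _ ih₁ ih₂ =>
    simp only [State.space, State.tick] at *
    omega
  | loopFalse _ => simp [State.space, State.tick]
  | build =>
    simp only [State.space, State.tick, State.addTable, List.map_append, List.sum_append,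
      List.map_singleton, List.sum_singleton]
    omega
  | query s t _ a b =>
    have := Finset.card_insert_le (a, 0) s.natCells
    have := Finset.card_insert_le (b, 0) s.realCells
    have : 1 ≤ t.size := by cases t <;> simp [NExp.size]
    simp only [State.space, State.tick, State.answer, State.writeNat, State.writeReal]
    omega

namespace Cmd

/-- The weakest precondition of a program for a postcondition `Q`: started in `s` with the random
tape `ω`, the program halts in a configuration that satisfies `Q`. -/
def wp (ω : ℕ → M.fam.Fn × unitInterval) (p : Cmd) (Q : State M → Prop) (s : State M) : Prop :=
  ∃ s', Exec M ω p s s' ∧ Q s'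

variable {p q : Cmd} {b : Test} {Q Q' : State M → Prop} {s : State M}

theorem wp.imp (h : p.wp ω Q s) (hQ : ∀ s', Frame p s s' → Q s' → Q' s') : p.wp ω Q' s :=
  let ⟨s', hp, hQs'⟩ := h
  ⟨s', hp, hQ s' hp.frame hQs'⟩

@[simp] theorem wp_skip : skip.wp ω Q s ↔ Q (s.tick 1) :=
  ⟨fun ⟨_, h, hQ⟩ => by cases h; exact hQ, fun hQ => ⟨_, .skip s, hQ⟩⟩

@[simp] theorem wp_setNat {a : ℕ} {i e : NExp} : (setNat a i e).wp ω Q s ↔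
    Q ((s.writeNat a (i.eval s) (e.eval s)).tick (i.size + e.size + 1)) :=
  ⟨fun ⟨_, h, hQ⟩ => by cases h; exact hQ, fun hQ => ⟨_, .setNat s a i e, hQ⟩⟩

@[simp] theorem wp_setReal {a : ℕ} {i : NExp} {e : RExp} : (setReal a i e).wp ω Q s ↔
    Q ((s.writeReal a (i.eval s) (e.eval s)).tick (i.size + e.size + 1)) :=
  ⟨fun ⟨_, h, hQ⟩ => by cases h; exact hQ, fun hQ => ⟨_, .setReal s a i e, hQ⟩⟩

@[simp] theorem wp_seq : (seq p q).wp ω Q s ↔ p.wp ω (q.wp ω Q) s :=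
  ⟨fun ⟨_, h, hQ⟩ => by cases h with | seq hp hq => exact ⟨_, hp, _, hq, hQ⟩,
    fun ⟨_, hp, _, hq, hQ⟩ => ⟨_, .seq hp hq, hQ⟩⟩

theorem wp_ite (htrue : b.Holds s → p.wp ω Q (s.tick b.size))
    (hfalse : ¬ b.Holds s → q.wp ω Q (s.tick b.size)) : (ite b p q).wp ω Q s := by
  by_cases hb : b.Holds s
  · obtain ⟨s', hp, hQ⟩ := htrue hb
    exact ⟨s', .iteTrue hb hp, hQ⟩
  · obtain ⟨s', hq, hQ⟩ := hfalse hb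
    exact ⟨s', .iteFalse hb hq, hQ⟩

theorem wp_build {a : ℕ} {m : NExp} (S : List (Fin n))
    (hS : S.map Fin.val = (List.range (m.eval s)).map (s.natMem a))
    (hQ : Q ((s.addTable (ω s.draws).1 S).tick (m.size + 1 + M.cost * S.length))) :
    (build a m).wp ω Q s :=
  ⟨_, .build s a m S hS, hQ⟩

theorem wp_query {t q : NExp} {a b : ℕ} {h : M.fam.Fn} {S : List (Fin n)} {i : Fin n}
    (ht : s.tables[t.eval s]? = some (h, S)) (hi : (i : ℕ) = q.eval s)
    (hQ : Q ((s.answer a b (M.fam.draw M.pt S h (ω s.draws).2 (M.pt i))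
      (M.fam.estimate M.ker M.pt S h (ω s.draws).2 (M.pt i))).tick
        (t.size + q.size + 1 + M.cost))) :
    (query t q a b).wp ω Q s :=
  ⟨_, .query s t q a b h S i ht hi, hQ⟩

theorem wp_loop (I : ℕ → State M → Prop) (m c : ℕ) (h0 : I 0 s)
    (hstep : ∀ k < m, ∀ s', I k s' → Frame p s s' → b.Holds s' ∧
      p.wp ω (fun s'' => s''.time ≤ s'.time + c ∧ I (k + 1) s'') (s'.tick b.size))
    (hend : ∀ s', I m s' → Frame p s s' → s'.time ≤ s.time + m * c →
      ¬ b.Holds s' ∧ Q (s'.tick b.size)) :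
    (loop b p).wp ω Q s := by
  suffices H : ∀ r k, k + r = m → ∀ s', I k s' → Frame p s s' → s'.time ≤ s.time + k * c →
      (loop b p).wp ω Q s' from H m 0 (by omega) s h0 (Frame.refl _ _) (by simp)
  intro r
  induction r with
  | zero =>
    rintro k rfl s' hI hf ht
    obtain ⟨hb, hQ⟩ := hend s' hI hf ht
    exact ⟨_, .loopFalse hb, hQ⟩
  | succ r ih =>
    intro k hk s' hI hf ht
    obtain ⟨hb, s₁, hp, ht₁, hI₁⟩ := hstep k (by omega) s' hI hf
    obtain ⟨s₂, hl, hQ⟩ := ih (k + 1) (by omega) s₁ hI₁ (hf.trans hp.frame.of_tick)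
      (by rw [Nat.succ_mul]; omega)
    exact ⟨s₂, .loopTrue hb hp hl, hQ⟩

end Cmd

end Machine

/-! ### The program -/

/- The arrays `members`, `weights`, `params`, `output` and `sums` are indexed; of every other array
only the entry `0` is used, as a variable. -/

namespace NatArray

@[simp] abbrev size : ℕ := 0
@[simp] abbrev digits : ℕ := 1
@[simp] abbrev samples : ℕ := 3
@[simp] abbrev digit : ℕ := 4
@[simp] abbrev count : ℕ := 5
@[simp] abbrev scan : ℕ := 6
@[simp] abbrev members : ℕ := 7
@[simp] abbrev rep : ℕ := 8
@[simp] abbrev offset : ℕ := 9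
@[simp] abbrev sample : ℕ := 10
@[simp] abbrev table : ℕ := 11
@[simp] abbrev point : ℕ := 12
@[simp] abbrev drawn : ℕ := 13
@[simp] abbrev rank : ℕ := 14
@[simp] abbrev rankRep : ℕ := 15
@[simp] abbrev rankOffset : ℕ := 16

end NatArray

namespace RealArray

@[simp] abbrev weights : ℕ := 0
@[simp] abbrev params : ℕ := 1
@[simp] abbrev output : ℕ := 2
@[simp] abbrev scale : ℕ := 3
@[simp] abbrev answer : ℕ := 4
@[simp] abbrev sums : ℕ := 5
@[simp] abbrev factor : ℕ := 6

end RealArray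

namespace NExp

/-- The natural number stored in entry `0` of an array. -/
abbrev var (a : ℕ) : NExp := get a (lit 0)

end NExp

namespace RExp

/-- The real number stored in entry `0` of an array. -/
abbrev var (a : ℕ) : RExp := get a (NExp.lit 0)

/-- The input `ε`. -/
abbrev epsilon : RExp := get RealArray.params (NExp.lit 0)

/-- The input `τ`. -/
abbrev tau : RExp := get RealArray.params (NExp.lit 1)

end RExp

namespace Cmd

abbrev setNatVar (a : ℕ) (e : NExp) : Cmd := setNat a (.lit 0) e

abbrev setRealVar (a : ℕ) (e : RExp) : Cmd := setReal a (.lit 0) e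

abbrev incr (a : ℕ) : Cmd := setNatVar a (.add (.var a) (.lit 1))

end Cmd

section Program

open Cmd

local infixr:60 " ;; " => Cmd.seq

/-- Query the newest table at one point, and add the scaled answer to the sum of the current
repetition at that point. The sum of repetition `r` at point `i` is entry `r * n + i`. -/
def queryStep : Cmd :=
  .query (.var NatArray.table) (.var NatArray.point) NatArray.drawn RealArray.answer ;;
  .setReal RealArray.sums (.add (.var NatArray.offset) (.var NatArray.point))
    (.add (.get RealArray.sums (.add (.var NatArray.offset) (.var NatArray.point)))
      (.mul (.var RealArray.factor) (.var RealArray.answer))) ;;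
  incr NatArray.point

def queryLoop : Cmd := .loop (.natLt (.var NatArray.point) (.var NatArray.size)) queryStep

def sampleStep : Cmd :=
  .build NatArray.members (.var NatArray.count) ;;
  setNatVar NatArray.point (.lit 0) ;;
  queryLoop ;;
  incr NatArray.table ;;
  incr NatArray.sample

def sampleLoop : Cmd := .loop (.natLt (.var NatArray.sample) (.var NatArray.samples)) sampleStep

def repStep : Cmd :=
  setNatVar NatArray.sample (.lit 0) ;;
  sampleLoop ;;
  setNatVar NatArray.offset (.add (.var NatArray.offset) (.var NatArray.size)) ;;
  incr NatArray.rep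

def repLoop : Cmd :=
  .loop (.natLt (.var NatArray.rep) (.add (.var NatArray.digits) (.var NatArray.digits))) repStep

/-- Subtract the current binary digit from one weight; a point whose digit is `1` joins the
members of the current level. -/
def digitStep : Cmd :=
  .ite (.realLe (.var RealArray.scale) (.get RealArray.weights (.var NatArray.scan)))
    (.setNat NatArray.members (.var NatArray.count) (.var NatArray.scan) ;;
      incr NatArray.count ;;
      .setReal RealArray.weights (.var NatArray.scan)
        (.sub (.get RealArray.weights (.var NatArray.scan)) (.var RealArray.scale)))
    .skip ;;
  incr NatArray.scan

def digitLoop : Cmd := .loop (.natLt (.var NatArray.scan) (.var NatArray.size)) digitStep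

/-- Add the contribution of one binary digit of the weights to the sums of all repetitions. -/
def levelStep : Cmd :=
  setNatVar NatArray.count (.lit 0) ;;
  setNatVar NatArray.scan (.lit 0) ;;
  digitLoop ;;
  setRealVar RealArray.factor (.div (.mul (.var RealArray.scale) (.ofNat (.var NatArray.count)))
    (.ofNat (.var NatArray.samples))) ;;
  setNatVar NatArray.rep (.lit 0) ;;
  setNatVar NatArray.offset (.lit 0) ;;
  repLoop ;;
  setRealVar RealArray.scale (.div (.var RealArray.scale) (.lit 2)) ;;
  incr NatArray.digit

def levelLoop : Cmd := .loop (.natLt (.var NatArray.digit) (.var NatArray.digits)) levelStep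

/-- One step of counting the repetitions whose sum is at least that of the current one. -/
def rankStep : Cmd :=
  .ite (.realLe (.get RealArray.sums (.var NatArray.offset))
      (.get RealArray.sums (.var NatArray.rankOffset)))
    (incr NatArray.rank) .skip ;;
  setNatVar NatArray.rankOffset (.add (.var NatArray.rankOffset) (.var NatArray.size)) ;;
  incr NatArray.rankRep

def rankLoop : Cmd :=
  .loop (.natLt (.var NatArray.rankRep) (.add (.var NatArray.digits) (.var NatArray.digits)))
    rankStep

/-- Raise the output at the current point to the sum of the current repetition, provided that at
least half of the repetitions have at least this sum. -/
def raiseOutput : Cmd :=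
  .ite (.natLt (.var NatArray.rank) (.var NatArray.digits)) .skip
    (.ite (.realLt (.get RealArray.output (.var NatArray.point))
        (.get RealArray.sums (.var NatArray.offset)))
      (.setReal RealArray.output (.var NatArray.point)
        (.get RealArray.sums (.var NatArray.offset))) .skip)

def selectStep : Cmd :=
  setNatVar NatArray.rank (.lit 0) ;;
  setNatVar NatArray.rankRep (.lit 0) ;;
  setNatVar NatArray.rankOffset (.var NatArray.point) ;;
  rankLoop ;;
  raiseOutput ;;
  setNatVar NatArray.offset (.add (.var NatArray.offset) (.var NatArray.size)) ;;
  incr NatArray.rep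

def selectLoop : Cmd :=
  .loop (.natLt (.var NatArray.rep) (.add (.var NatArray.digits) (.var NatArray.digits)))
    selectStep

def outStep : Cmd :=
  setNatVar NatArray.rep (.lit 0) ;;
  setNatVar NatArray.offset (.var NatArray.point) ;;
  selectLoop ;;
  incr NatArray.point

def outLoop : Cmd := .loop (.natLt (.var NatArray.point) (.var NatArray.size)) outStep

def depthStep : Cmd :=
  setRealVar RealArray.scale (.div (.var RealArray.scale) (.lit 2)) ;;
  incr NatArray.digits

/-- Compute the number of binary digits: the scale is halved until the weight below it, which is at
most `n` times the scale, is at most `ε * τ`. -/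
def depthLoop : Cmd :=
  .loop (.realLt (.mul .epsilon .tau) (.mul (.ofNat (.var NatArray.size)) (.var RealArray.scale)))
    depthStep

/-- Compute the number of samples per repetition and digit, `⌈16 * (1 + V (ε * τ)) / ε ^ 2⌉`, by
counting. -/
def sizeLoop : Cmd :=
  .loop (.realLt (.ofNat (.var NatArray.samples))
      (.div (.mul (.lit 16) (.add (.lit 1) (.bound (.mul .epsilon .tau))))
        (.mul .epsilon .epsilon)))
    (incr NatArray.samples)

/-- Approximate multiplication of a vector by a kernel matrix. -/
def program : Cmd :=
  setNatVar NatArray.digits (.lit 1) ;;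
  setRealVar RealArray.scale (.lit 1) ;;
  depthLoop ;;
  sizeLoop ;;
  setRealVar RealArray.scale (.lit 1) ;;
  levelLoop ;;
  setNatVar NatArray.point (.lit 0) ;;
  outLoop

end Program

/-! ### Correctness and running time -/

section Specs

open Cmd

variable {E : Type w} {n : ℕ} {M : Env.{u, v, w} E n} {ω : ℕ → M.fam.Fn × unitInterval}

attribute [local simp] NExp.eval NExp.size RExp.eval RExp.size Test.Holds Test.size

theorem mul_add_fin_inj {r r' : ℕ} {i i' : Fin n} :
    r * n + (i : ℕ) = r' * n + i' ↔ r = r' ∧ i = i' := by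
  refine ⟨fun h => ?_, by rintro ⟨rfl, rfl⟩; rfl⟩
  have hdiv (r : ℕ) (i : Fin n) : (r * n + i) / n = r := by
    rw [mul_comm, Nat.mul_add_div i.pos, Nat.div_eq_of_lt i.isLt, add_zero]
  have hr : r = r' := by rw [← hdiv r i, h, hdiv]
  subst hr
  exact ⟨rfl, Fin.ext (Nat.add_left_cancel h)⟩

/-- The sum that repetition `r` has collected at point `i`. -/
def State.sums (s : State M) (r : ℕ) (i : Fin n) : ℝ :=
  s.realMem RealArray.sums (r * n + i)

@[simp] theorem State.sums_tick (s : State M) (c : ℕ) : (s.tick c).sums = s.sums := rfl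

@[simp] theorem State.sums_writeNat (s : State M) (a i x : ℕ) :
    (s.writeNat a i x).sums = s.sums := rfl

@[simp] theorem State.sums_addTable (s : State M) (h : M.fam.Fn) (S : List (Fin n)) :
    (s.addTable h S).sums = s.sums := rfl

/-- The answer of the table number `g` to the query at point `i`. With the `n` queries of each
table following its construction, table `g` consumes the entries from `g * (n + 1)` to
`g * (n + 1) + n` of the tape. -/
noncomputable def answer (M : Env.{u, v, w} E n) (ω : ℕ → M.fam.Fn × unitInterval)
    (S : List (Fin n)) (g : ℕ) (i : Fin n) : ℝ :=
  M.fam.estimate M.ker M.pt S (ω (g * (n + 1))).1 (ω (g * (n + 1) + 1 + i)).2 (M.pt i)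

theorem queryStep_spec {s : State M} {S : List (Fin n)} {g r : ℕ} {i : Fin n}
    (hpoint : s.natMem NatArray.point 0 = i) (hoffset : s.natMem NatArray.offset 0 = r * n)
    (htable : s.tables[s.natMem NatArray.table 0]? = some ((ω (g * (n + 1))).1, S))
    (hdraws : s.draws = g * (n + 1) + 1 + i) :
    queryStep.wp ω (fun s' => s'.time ≤ s.time + (M.cost + 35) ∧
      s'.natMem NatArray.point 0 = i + 1 ∧ s'.draws = s.draws + 1 ∧ s'.tables = s.tables ∧
      ∀ r' i', s'.sums r' i' = s.sums r' i' +
        if r' = r ∧ i' = i then s.realMem RealArray.factor 0 * answer M ω S g i else 0) s := by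
  refine wp_seq.2 (wp_query htable (by simpa using hpoint.symm) (wp_seq.2 ?_))
  refine wp_setReal.2 (wp_setNat.2 ⟨?_, ?_, ?_, ?_, fun r' i' => ?_⟩)
  · simp only [NExp.size, RExp.size, State.time_tick, State.time_writeNat, State.time_writeReal,
      State.time_answer]
    omega
  · simp [hpoint]
  · simp
  · simp
  · by_cases h : r' = r ∧ i' = i <;>
      simp [State.sums, hpoint, hoffset, mul_add_fin_inj, h, answer, hdraws]

theorem queryLoop_spec {s : State M} {S : List (Fin n)} {g r : ℕ}
    (hsize : s.natMem NatArray.size 0 = n) (hpoint : s.natMem NatArray.point 0 = 0)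
    (hoffset : s.natMem NatArray.offset 0 = r * n)
    (htable : s.tables[s.natMem NatArray.table 0]? = some ((ω (g * (n + 1))).1, S))
    (hdraws : s.draws = g * (n + 1) + 1) :
    queryLoop.wp ω (fun s' => s'.time ≤ s.time + (n * (M.cost + 40) + 5) ∧
      s'.draws = s.draws + n ∧ s'.tables = s.tables ∧ ∀ r' i, s'.sums r' i = s.sums r' i +
        if r' = r then s.realMem RealArray.factor 0 * answer M ω S g i else 0) s := by
  refine wp_loop (fun k s' => s'.natMem NatArray.point 0 = k ∧ s'.draws = s.draws + k ∧
      s'.tables = s.tables ∧ ∀ r' i, s'.sums r' i = s.sums r' i +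
        if r' = r ∧ i < k then s.realMem RealArray.factor 0 * answer M ω S g i else 0)
    n (M.cost + 40) ⟨hpoint, rfl, rfl, by simp⟩ ?_ ?_
  · rintro k hk s' ⟨hpoint', hdraws', htables', hsums⟩ hf
    have hfactor := hf.real RealArray.factor (by decide) 0
    refine ⟨by simp +decide [hf.nat, hsize, hpoint', hk], ?_⟩
    refine (queryStep_spec (S := S) (g := g) (r := r) (i := ⟨k, hk⟩) (by simpa using hpoint')
      (by simp +decide [hf.nat, hoffset]) (by simp +decide [hf.nat, htables', htable])
      (by simp [hdraws', hdraws])).imp ?_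
    rintro s'' - ⟨htime'', hpoint'', hdraws'', htables'', hsums''⟩
    simp only [Test.size, NExp.size, State.time_tick] at htime''
    refine ⟨by omega, hpoint'', by simp [hdraws'', hdraws', add_assoc],
      htables''.trans htables', fun r' i => ?_⟩
    rw [hsums'', State.sums_tick, hsums, State.realMem_tick, hfactor]
    rcases lt_trichotomy (i : ℕ) k with h | h | h
    · simp [h, Fin.ext_iff, h.ne, Nat.lt_succ_of_lt h]
    · obtain rfl : i = ⟨k, hk⟩ := Fin.ext h
      simp
    · simp [h.not_gt, Fin.ext_iff, h.ne', (Nat.succ_le_of_lt h).not_gt]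
  · rintro s' ⟨hpoint', hdraws', htables', hsums⟩ hf ht
    refine ⟨by simp +decide [hf.nat, hsize, hpoint'], ?_, hdraws', htables', fun r' i => ?_⟩
    · simpa [← add_assoc] using ht
    · simp [hsums]

/-- The members of the current level, as stored in memory, are the list `S`. -/
def State.Members (s : State M) (S : List (Fin n)) : Prop :=
  S.map Fin.val = (List.range (s.natMem NatArray.count 0)).map (s.natMem NatArray.members)

@[simp] theorem State.members_tick {s : State M} {c : ℕ} {S : List (Fin n)} :
    (s.tick c).Members S ↔ s.Members S := Iff.rfl

@[simp] theorem State.members_writeReal {s : State M} {a i : ℕ} {x : ℝ} {S : List (Fin n)} :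
    (s.writeReal a i x).Members S ↔ s.Members S := Iff.rfl

@[simp] theorem State.members_writeNat {s : State M} {a i x : ℕ} {S : List (Fin n)}
    (hcount : a ≠ NatArray.count) (hmembers : a ≠ NatArray.members) :
    (s.writeNat a i x).Members S ↔ s.Members S := by
  have h : (s.writeNat a i x).natMem NatArray.members = s.natMem NatArray.members :=
    funext fun j => by rw [State.natMem_writeNat, if_neg fun h => hmembers h.1.symm]
  rw [State.Members, State.Members, h, State.natMem_writeNat, if_neg fun h => hcount h.1.symm]

theorem Frame.members {p : Cmd} {s s' : State M} {S : List (Fin n)} (hf : Frame p s s')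
    (hS : s.Members S) (hcount : p.writesNat NatArray.count = false)
    (hmembers : p.writesNat NatArray.members = false) : s'.Members S := by
  have h : s'.natMem NatArray.members = s.natMem NatArray.members := funext (hf.nat _ hmembers)
  rwa [State.Members, h, hf.nat _ hcount]

/-- So far `g` tables have been formed, and each of them has been queried at all points. -/
structure State.Drawn (s : State M) (g : ℕ) : Prop where
  table : s.natMem NatArray.table 0 = g
  length_tables : s.tables.length = g
  draws : s.draws = g * (n + 1)

@[simp] theorem State.drawn_tick {s : State M} {c g : ℕ} : (s.tick c).Drawn g ↔ s.Drawn g :=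
  ⟨fun h => ⟨h.1, h.2, h.3⟩, fun h => ⟨h.1, h.2, h.3⟩⟩

@[simp] theorem State.drawn_writeReal {s : State M} {a i g : ℕ} {x : ℝ} :
    (s.writeReal a i x).Drawn g ↔ s.Drawn g :=
  ⟨fun h => ⟨h.1, h.2, h.3⟩, fun h => ⟨h.1, h.2, h.3⟩⟩

@[simp] theorem State.drawn_writeNat {s : State M} {a i x g : ℕ} (ha : a ≠ NatArray.table) :
    (s.writeNat a i x).Drawn g ↔ s.Drawn g := by
  have h : (s.writeNat a i x).natMem NatArray.table 0 = s.natMem NatArray.table 0 := by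
    rw [State.natMem_writeNat, if_neg fun h => ha h.1.symm]
  exact ⟨fun hg => ⟨h ▸ hg.1, hg.2, hg.3⟩, fun hg => ⟨h.trans hg.1, hg.2, hg.3⟩⟩

theorem Frame.drawn {p : Cmd} {s s' : State M} {g : ℕ} (hf : Frame p s s') (hg : s.Drawn g)
    (htable : p.writesNat NatArray.table = false) (htape : p.usesTape = false) : s'.Drawn g :=
  ⟨(hf.nat _ htable 0).trans hg.table, (congrArg _ (hf.tables htape)).trans hg.length_tables,
    (hf.draws htape).trans hg.draws⟩

theorem sampleStep_spec {s : State M} {S : List (Fin n)} {g r : ℕ}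
    (hsize : s.natMem NatArray.size 0 = n) (hoffset : s.natMem NatArray.offset 0 = r * n)
    (hS : s.Members S) (hg : s.Drawn g) :
    sampleStep.wp ω (fun s' =>
      s'.time ≤ s.time + (n * (M.cost + 40) + M.cost * S.length + 30) ∧
      s'.natMem NatArray.sample 0 = s.natMem NatArray.sample 0 + 1 ∧ s'.Drawn (g + 1) ∧
      ∀ r' i, s'.sums r' i = s.sums r' i +
        if r' = r then s.realMem RealArray.factor 0 * answer M ω S g i else 0) s := by
  refine wp_seq.2 (wp_build S hS (wp_seq.2 (wp_setNat.2 (wp_seq.2 ?_))))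
  refine (queryLoop_spec (S := S) (g := g) (r := r) (by simp [hsize]) (by simp) (by simp [hoffset])
    (by simp [hg.table, hg.draws, ← hg.length_tables]) (by simp [hg.draws])).imp ?_
  rintro s' hf ⟨htime, hdraws, htables, hsums⟩
  refine wp_seq.2 (wp_setNat.2 (wp_setNat.2 ⟨?_, ?_, ⟨?_, ?_, ?_⟩, fun r' i => ?_⟩))
  · simp only [NExp.size, State.time_tick, State.time_writeNat,
      State.time_addTable] at htime ⊢
    omega
  · simp +decide [hf.nat]
  · simp +decide [hf.nat, hg.table]
  · simp [htables, hg.length_tables]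
  · simp only [State.draws_tick, State.draws_writeNat, State.draws_addTable, hdraws, hg.draws]
    ring
  · simp [hsums]

theorem sampleLoop_spec {s : State M} {S : List (Fin n)} {N g r : ℕ}
    (hsize : s.natMem NatArray.size 0 = n) (hsample : s.natMem NatArray.sample 0 = 0)
    (hN : s.natMem NatArray.samples 0 = N) (hoffset : s.natMem NatArray.offset 0 = r * n)
    (hS : s.Members S) (hg : s.Drawn g) :
    sampleLoop.wp ω (fun s' =>
      s'.time ≤ s.time + (N * (n * (M.cost + 40) + M.cost * S.length + 40) + 5) ∧
      s'.Drawn (g + N) ∧ ∀ r' i, s'.sums r' i = s.sums r' i + if r' = r then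
        s.realMem RealArray.factor 0 * ∑ l ∈ Finset.range N, answer M ω S (g + l) i else 0) s := by
  refine wp_loop (fun k s' => s'.natMem NatArray.sample 0 = k ∧ s'.Drawn (g + k) ∧
      ∀ r' i, s'.sums r' i = s.sums r' i + if r' = r then
        s.realMem RealArray.factor 0 * ∑ l ∈ Finset.range k, answer M ω S (g + l) i else 0)
    N (n * (M.cost + 40) + M.cost * S.length + 40) ⟨hsample, hg, by simp⟩ ?_ ?_
  · rintro k hk s' ⟨hsample', hg', hsums'⟩ hf
    refine ⟨by simp +decide [hf.nat, hN, hsample', hk], ?_⟩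
    refine (sampleStep_spec (S := S) (g := g + k) (r := r) (by simp +decide [hf.nat, hsize])
      (by simp +decide [hf.nat, hoffset]) (by simpa using hf.members hS rfl rfl)
      (by simpa using hg')).imp ?_
    rintro s'' - ⟨htime'', hsample'', hg'', hsums''⟩
    simp only [Test.size, NExp.size, State.time_tick] at htime''
    refine ⟨by omega, by simp [hsample'', hsample'], hg'', fun r' i => ?_⟩
    rw [hsums'', State.sums_tick, hsums', State.realMem_tick, hf.real _ rfl, Finset.sum_range_succ]
    split_ifs <;> ring
  · rintro s' ⟨hsample', hg', hsums'⟩ hf ht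
    exact ⟨by simp +decide [hf.nat, hN, hsample'], by simpa [← add_assoc] using ht,
      by simpa using hg', hsums'⟩

theorem repStep_spec {s : State M} {S : List (Fin n)} {N g r : ℕ}
    (hsize : s.natMem NatArray.size 0 = n) (hN : s.natMem NatArray.samples 0 = N)
    (hoffset : s.natMem NatArray.offset 0 = r * n) (hS : s.Members S) (hg : s.Drawn g) :
    repStep.wp ω (fun s' =>
      s'.time ≤ s.time + (N * (n * (M.cost + 40) + M.cost * S.length + 40) + 30) ∧
      s'.natMem NatArray.rep 0 = s.natMem NatArray.rep 0 + 1 ∧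
      s'.natMem NatArray.offset 0 = (r + 1) * n ∧ s'.Drawn (g + N) ∧
      ∀ r' i, s'.sums r' i = s.sums r' i + if r' = r then
        s.realMem RealArray.factor 0 * ∑ l ∈ Finset.range N, answer M ω S (g + l) i else 0) s := by
  refine wp_seq.2 (wp_setNat.2 (wp_seq.2 ?_))
  refine (sampleLoop_spec (S := S) (N := N) (g := g) (r := r) (by simp [hsize]) (by simp)
    (by simp [hN]) (by simp [hoffset]) (by simpa using hS) (by simpa using hg)).imp ?_
  rintro s' hf ⟨htime, hg', hsums⟩
  refine wp_seq.2 (wp_setNat.2 (wp_setNat.2 ⟨?_, ?_, ?_, by simpa using hg', by simpa using hsums⟩))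
  · simp only [NExp.size, State.time_tick, State.time_writeNat] at htime ⊢
    omega
  · simp +decide [hf.nat]
  · simp +decide [hf.nat, hoffset, hsize, Nat.succ_mul]

theorem repLoop_spec {s : State M} {S : List (Fin n)} {L N g : ℕ}
    (hsize : s.natMem NatArray.size 0 = n) (hL : s.natMem NatArray.digits 0 = L)
    (hN : s.natMem NatArray.samples 0 = N) (hrep : s.natMem NatArray.rep 0 = 0)
    (hoffset : s.natMem NatArray.offset 0 = 0) (hS : s.Members S) (hg : s.Drawn g) :
    repLoop.wp ω (fun s' => s'.time ≤
        s.time + (2 * L * (N * (n * (M.cost + 40) + M.cost * S.length + 40) + 40) + 8) ∧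
      s'.Drawn (g + 2 * L * N) ∧ ∀ r < 2 * L, ∀ i, s'.sums r i = s.sums r i +
        s.realMem RealArray.factor 0 *
          ∑ l ∈ Finset.range N, answer M ω S (g + r * N + l) i) s := by
  refine wp_loop (fun k s' => s'.natMem NatArray.rep 0 = k ∧
      s'.natMem NatArray.offset 0 = k * n ∧ s'.Drawn (g + k * N) ∧
      ∀ r i, s'.sums r i = s.sums r i + if r < k then
        s.realMem RealArray.factor 0 *
          ∑ l ∈ Finset.range N, answer M ω S (g + r * N + l) i else 0)
    (2 * L) (N * (n * (M.cost + 40) + M.cost * S.length + 40) + 40)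
    ⟨hrep, by simpa using hoffset, by simpa using hg, by simp⟩ ?_ ?_
  · rintro k hk s' ⟨hrep', hoffset', hg', hsums'⟩ hf
    refine ⟨by simpa +decide [hf.nat, hL, hrep', two_mul] using hk, ?_⟩
    refine (repStep_spec (S := S) (N := N) (r := k) (by simp +decide [hf.nat, hsize])
      (by simp +decide [hf.nat, hN]) (by simp [hoffset'])
      (by simpa using hf.members hS rfl rfl) (by simpa using hg')).imp ?_
    rintro s'' - ⟨htime'', hrep'', hoffset'', hg'', hsums''⟩
    simp only [Test.size, NExp.size, State.time_tick] at htime''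
    refine ⟨by omega, by simp [hrep'', hrep'], hoffset'',
      by simpa [Nat.succ_mul, add_assoc] using hg'', fun r i => ?_⟩
    rw [hsums'', State.sums_tick, hsums', State.realMem_tick, hf.real _ rfl]
    rcases lt_trichotomy r k with h | rfl | h
    · simp [h, h.ne, Nat.lt_succ_of_lt h]
    · simp
    · simp [h.not_gt, h.ne', (Nat.succ_le_of_lt h).not_gt]
  · rintro s' ⟨hrep', -, hg', hsums'⟩ hf ht
    refine ⟨by simp +decide [hf.nat, hL, hrep', two_mul], by simpa [← add_assoc] using ht,
      by simpa using hg', fun r hr i => ?_⟩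
    rw [State.sums_tick, hsums', if_pos hr]

end Specs

section Digits

/-- What is left of the number `x` after removing its binary digits of the places
`1, 1 / 2, …, (1 / 2) ^ (b - 1)`, each of them `0` or `1`. -/
noncomputable def residual (x : ℝ) : ℕ → ℝ
  | 0 => x
  | b + 1 => if (1 / 2) ^ b ≤ residual x b then residual x b - (1 / 2) ^ b else residual x b

variable {n : ℕ}

/-- The points whose weight has the binary digit `1` at place `(1 / 2) ^ b`. -/
noncomputable def level (z : Fin n → ℝ) (b : ℕ) : List (Fin n) :=
  (List.finRange n).filter fun j => (1 / 2) ^ b ≤ residual (z j) b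

theorem length_level_le (z : Fin n → ℝ) (b : ℕ) : (level z b).length ≤ n :=
  (List.length_filter_le _ _).trans_eq (List.length_finRange)

end Digits

section Specs

open Cmd

variable {E : Type w} {n : ℕ} {M : Env.{u, v, w} E n} {ω : ℕ → M.fam.Fn × unitInterval}

attribute [local simp] NExp.eval NExp.size RExp.eval RExp.size Test.Holds Test.size

theorem State.Members.count_eq {s : State M} {S : List (Fin n)} (hS : s.Members S) :
    s.natMem NatArray.count 0 = S.length := by
  simpa using (congrArg List.length hS).symm

theorem State.Members.concat {s : State M} {S : List (Fin n)} (hS : s.Members S) (i : Fin n)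
    (c : ℕ) :
    (((s.writeNat NatArray.members (s.natMem NatArray.count 0) i).tick c).writeNat NatArray.count 0
      (s.natMem NatArray.count 0 + 1)).Members (S ++ [i]) := by
  simp only [State.Members, List.map_append, State.natMem_writeNat, and_self, if_true,
    List.range_succ]
  congr 1
  · refine hS.trans (List.map_congr_left fun j hj => ?_)
    simp [(List.mem_range.1 hj).ne]
  · simp

theorem digitStep_spec {s : State M} {S : List (Fin n)} {k : Fin n}
    (hscan : s.natMem NatArray.scan 0 = k) (hS : s.Members S) :
    digitStep.wp ω (fun s' => s'.time ≤ s.time + 35 ∧ s'.natMem NatArray.scan 0 = k + 1 ∧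
      s'.Members (S ++ if s.realMem RealArray.scale 0 ≤ s.realMem RealArray.weights k
        then [k] else []) ∧
      ∀ j : Fin n, s'.realMem RealArray.weights j = if j = k ∧
        s.realMem RealArray.scale 0 ≤ s.realMem RealArray.weights k then
          s.realMem RealArray.weights k - s.realMem RealArray.scale 0
        else s.realMem RealArray.weights j) s := by
  refine wp_seq.2 (wp_ite (fun h => ?_) fun h => ?_)
  · have h' : s.realMem RealArray.scale 0 ≤ s.realMem RealArray.weights k := by
      simpa [hscan] using h
    refine wp_seq.2 (wp_setNat.2 (wp_seq.2 (wp_setNat.2 (wp_setReal.2 (wp_setNat.2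
      ⟨by simp, by simp [hscan], ?_, fun j => ?_⟩)))))
    · simpa [h', hscan] using (State.members_tick (c := 6).2 hS).concat k 5
    · simp [h', hscan, Fin.ext_iff]
  · have h' : ¬ s.realMem RealArray.scale 0 ≤ s.realMem RealArray.weights k := by
      simpa [hscan] using h
    refine wp_skip.2 (wp_setNat.2 ⟨by simp, by simp [hscan], by simpa [h'] using hS, fun j => ?_⟩)
    simp [h']

theorem digitLoop_spec {s : State M} (hsize : s.natMem NatArray.size 0 = n)
    (hcount : s.natMem NatArray.count 0 = 0) (hscan : s.natMem NatArray.scan 0 = 0) :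
    digitLoop.wp ω (fun s' => s'.time ≤ s.time + (n * 40 + 5) ∧
      s'.Members ((List.finRange n).filter fun j =>
        s.realMem RealArray.scale 0 ≤ s.realMem RealArray.weights j) ∧
      ∀ j : Fin n, s'.realMem RealArray.weights j =
        if s.realMem RealArray.scale 0 ≤ s.realMem RealArray.weights j then
          s.realMem RealArray.weights j - s.realMem RealArray.scale 0
        else s.realMem RealArray.weights j) s := by
  refine wp_loop (fun k s' => s'.natMem NatArray.scan 0 = k ∧
      s'.Members (((List.finRange n).take k).filter fun j =>
        s.realMem RealArray.scale 0 ≤ s.realMem RealArray.weights j) ∧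
      ∀ j : Fin n, s'.realMem RealArray.weights j =
        if j < k ∧ s.realMem RealArray.scale 0 ≤ s.realMem RealArray.weights j then
          s.realMem RealArray.weights j - s.realMem RealArray.scale 0
        else s.realMem RealArray.weights j)
    n 40 ⟨hscan, by simp [State.Members, hcount], by simp⟩ ?_ ?_
  · rintro k hk s' ⟨hscan', hS', hweights'⟩ hf
    refine ⟨by simp +decide [hf.nat, hsize, hscan', hk], ?_⟩
    refine (digitStep_spec (k := ⟨k, hk⟩) (by simpa using hscan')
      (State.members_tick.2 hS')).imp ?_
    rintro s'' - ⟨htime'', hscan'', hS'', hweights''⟩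
    have hk' := hweights' ⟨k, hk⟩
    simp only [lt_irrefl, false_and, if_false] at hk'
    simp only [State.realMem_tick, hf.real RealArray.scale rfl, hk'] at hS'' hweights''
    refine ⟨by simpa [add_assoc] using htime'', hscan'', ?_, fun j => ?_⟩
    · simpa [List.take_add_one, List.filter_cons, hk] using hS''
    · rw [hweights'', hweights']
      rcases lt_trichotomy (j : ℕ) k with h | h | h
      · simp [h, Fin.ext_iff, h.ne, Nat.lt_succ_of_lt h]
      · obtain rfl : j = ⟨k, hk⟩ := Fin.ext h
        simp
      · simp [h.not_gt, Fin.ext_iff, h.ne', (Nat.succ_le_of_lt h).not_gt]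
  · rintro s' ⟨hscan', hS', hweights'⟩ hf ht
    exact ⟨by simp +decide [hf.nat, hsize, hscan'], by simpa [← add_assoc] using ht,
      by simpa [List.take_of_length_le] using hS', fun j => by simp [hweights']⟩

/-- The contribution of the digit at place `(1 / 2) ^ b` to the sum of repetition `r` at point `i`,
if there are `L` digits, `2 * L` repetitions and `N` samples. -/
noncomputable def levelSum (M : Env.{u, v, w} E n) (ω : ℕ → M.fam.Fn × unitInterval)
    (z : Fin n → ℝ) (L N b r : ℕ) (i : Fin n) : ℝ :=
  (1 / 2) ^ b * (level z b).length / N *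
    ∑ l ∈ Finset.range N, answer M ω (level z b) (b * (2 * L * N) + r * N + l) i

theorem levelStep_spec {s : State M} {z : Fin n → ℝ} {L N b : ℕ}
    (hsize : s.natMem NatArray.size 0 = n) (hL : s.natMem NatArray.digits 0 = L)
    (hN : s.natMem NatArray.samples 0 = N) (hg : s.Drawn (b * (2 * L * N)))
    (hscale : s.realMem RealArray.scale 0 = (1 / 2) ^ b)
    (hweights : ∀ j : Fin n, s.realMem RealArray.weights j = residual (z j) b) :
    levelStep.wp ω (fun s' => s'.time ≤ s.time +
        (n * 40 + 2 * L * (N * (n * (M.cost + 40) + M.cost * n + 40) + 40) + 60) ∧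
      s'.natMem NatArray.digit 0 = s.natMem NatArray.digit 0 + 1 ∧
      s'.Drawn ((b + 1) * (2 * L * N)) ∧ s'.realMem RealArray.scale 0 = (1 / 2) ^ (b + 1) ∧
      (∀ j : Fin n, s'.realMem RealArray.weights j = residual (z j) (b + 1)) ∧
      ∀ r < 2 * L, ∀ i, s'.sums r i = s.sums r i + levelSum M ω z L N b r i) s := by
  refine wp_seq.2 (wp_setNat.2 (wp_seq.2 (wp_setNat.2 (wp_seq.2 ?_))))
  refine (digitLoop_spec (by simp [hsize]) (by simp) (by simp)).imp ?_
  rintro s₁ hf₁ ⟨htime₁, hS₁, hweights₁⟩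
  simp +decide only [State.realMem_tick, State.realMem_writeNat, hscale, hweights]
    at hS₁ hweights₁
  have hlevel : s₁.Members (level z b) := hS₁
  refine wp_seq.2 (wp_setReal.2 (wp_seq.2 (wp_setNat.2 (wp_seq.2 (wp_setNat.2 (wp_seq.2 ?_))))))
  refine (repLoop_spec (S := level z b) (L := L) (N := N) (g := b * (2 * L * N))
    (by simp +decide [hf₁.nat, hsize]) (by simp +decide [hf₁.nat, hL])
    (by simp +decide [hf₁.nat, hN]) (by simp) (by simp) (by simpa using hlevel)
    (by simpa using hf₁.drawn (by simpa using hg) rfl rfl)).imp ?_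
  rintro s₂ hf₂ ⟨htime₂, hg₂, hsums₂⟩
  refine wp_seq.2 (wp_setReal.2 (wp_setNat.2 ⟨?_, ?_, ?_, ?_, fun j => ?_, fun r hr i => ?_⟩))
  · have : N * (n * (M.cost + 40) + M.cost * (level z b).length + 40) ≤
        N * (n * (M.cost + 40) + M.cost * n + 40) := by
      gcongr
      exact length_level_le z b
    have := Nat.mul_le_mul_left (2 * L) (Nat.add_le_add_right this 40)
    simp only [NExp.size, RExp.size, State.time_tick, State.time_writeNat,
      State.time_writeReal] at htime₁ htime₂ ⊢
    omega
  · simp +decide [hf₁.nat, hf₂.nat]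
  · simpa [Nat.succ_mul] using hg₂
  · simp +decide [hf₁.real, hf₂.real, hscale, pow_succ, div_eq_mul_inv]
  · simp +decide [hf₂.real, hweights₁, residual]
  · simpa +decide [levelSum, State.sums, hf₁.nat, hf₁.real, hscale, hlevel.count_eq, hN] using
      hsums₂ r hr i

theorem levelLoop_spec {s : State M} {z : Fin n → ℝ} {L N : ℕ}
    (hsize : s.natMem NatArray.size 0 = n) (hL : s.natMem NatArray.digits 0 = L)
    (hN : s.natMem NatArray.samples 0 = N) (hdigit : s.natMem NatArray.digit 0 = 0)
    (hg : s.Drawn 0) (hscale : s.realMem RealArray.scale 0 = 1)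
    (hweights : ∀ j : Fin n, s.realMem RealArray.weights j = z j)
    (hsums : ∀ r i, s.sums r i = 0) :
    levelLoop.wp ω (fun s' => s'.time ≤ s.time + (L * (n * 40 +
        2 * L * (N * (n * (M.cost + 40) + M.cost * n + 40) + 40) + 70) + 5) ∧
      ∀ r < 2 * L, ∀ i, s'.sums r i = ∑ b ∈ Finset.range L, levelSum M ω z L N b r i) s := by
  refine wp_loop (fun k s' => s'.natMem NatArray.digit 0 = k ∧ s'.Drawn (k * (2 * L * N)) ∧
      s'.realMem RealArray.scale 0 = (1 / 2) ^ k ∧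
      (∀ j : Fin n, s'.realMem RealArray.weights j = residual (z j) k) ∧
      ∀ r < 2 * L, ∀ i, s'.sums r i = ∑ b ∈ Finset.range k, levelSum M ω z L N b r i)
    L (n * 40 + 2 * L * (N * (n * (M.cost + 40) + M.cost * n + 40) + 40) + 70)
    ⟨hdigit, by simpa using hg, by simpa using hscale, hweights, by simp [hsums]⟩ ?_ ?_
  · rintro k hk s' ⟨hdigit', hg', hscale', hweights', hsums'⟩ hf
    refine ⟨by simp +decide [hf.nat, hL, hdigit', hk], ?_⟩
    refine (levelStep_spec (L := L) (N := N) (by simp +decide [hf.nat, hsize])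
      (by simp +decide [hf.nat, hL]) (by simp +decide [hf.nat, hN]) (by simpa using hg')
      (by simpa using hscale') (by simpa using hweights')).imp ?_
    rintro s'' - ⟨htime'', hdigit'', hg'', hscale'', hweights'', hsums''⟩
    simp only [Test.size, NExp.size, State.time_tick] at htime''
    refine ⟨by omega, by simp [hdigit'', hdigit'], hg'', hscale'',
      hweights'', fun r hr i => ?_⟩
    rw [hsums'' r hr, State.sums_tick, hsums' r hr, Finset.sum_range_succ]
  · rintro s' ⟨hdigit', -, -, -, hsums'⟩ hf ht
    exact ⟨by simp +decide [hf.nat, hL, hdigit'], by simpa [← add_assoc] using ht, hsums'⟩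

end Specs

section Median

/-- How many of the numbers `a 0, …, a (2 * L - 1)` are at least `x`. -/
noncomputable def rank (a : ℕ → ℝ) (L : ℕ) (x : ℝ) : ℕ :=
  ((Finset.range (2 * L)).filter fun r => x ≤ a r).card

/-- The largest of the nonnegative numbers `a 0, …, a (2 * L - 1)` with rank at least `L`, which
is their upper median. -/
noncomputable def upperMedian (a : ℕ → ℝ) (L : ℕ) : ℝ :=
  ((Finset.range (2 * L)).filter fun r => L ≤ rank a L (a r)).fold max 0 a

theorem rank_congr {a a' : ℕ → ℝ} {L : ℕ} (h : ∀ r < 2 * L, a r = a' r) :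
    rank a L = rank a' L := by
  funext x
  exact congrArg Finset.card (Finset.filter_congr fun r hr => by rw [h r (Finset.mem_range.1 hr)])

theorem upperMedian_congr {a a' : ℕ → ℝ} {L : ℕ} (h : ∀ r < 2 * L, a r = a' r) :
    upperMedian a L = upperMedian a' L := by
  have hmem (r : ℕ) (hr : r ∈ Finset.range (2 * L)) : a r = a' r := h r (Finset.mem_range.1 hr)
  rw [upperMedian, upperMedian, rank_congr h]
  rw [Finset.filter_congr fun r hr => by rw [hmem r hr]]
  exact Finset.fold_congr fun r hr => hmem r (Finset.mem_of_mem_filter r hr)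

end Median

section Sizes

/-- The number of times `1` has to be halved to reach `t / n`. -/
noncomputable def depth (n : ℕ) (t : ℝ) : ℕ := Nat.clog 2 ⌈n / t⌉₊

theorem mul_half_pow_le_iff {n : ℕ} {t : ℝ} (ht : 0 < t) {k : ℕ} :
    n * (1 / 2) ^ k ≤ t ↔ depth n t ≤ k := by
  rw [depth, Nat.clog_le_iff_le_pow one_lt_two, Nat.ceil_le, div_le_iff₀ ht, one_div, inv_pow,
    ← div_eq_mul_inv, div_le_iff₀ (by positivity), mul_comm t]
  push_cast
  rfl

/-- The number of samples that each repetition averages for each digit. -/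
noncomputable def sampleSize (V : ℝ → ℝ) (ε τ : ℝ) : ℕ := ⌈16 * (1 + V (ε * τ)) / (ε * ε)⌉₊

end Sizes

section Specs

open Cmd

variable {E : Type w} {n : ℕ} {M : Env.{u, v, w} E n} {ω : ℕ → M.fam.Fn × unitInterval}

attribute [local simp] NExp.eval NExp.size RExp.eval RExp.size Test.Holds Test.size

theorem rankLoop_spec {s : State M} {L r : ℕ} {i : Fin n}
    (hsize : s.natMem NatArray.size 0 = n) (hL : s.natMem NatArray.digits 0 = L)
    (hrank : s.natMem NatArray.rank 0 = 0) (hrep : s.natMem NatArray.rankRep 0 = 0)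
    (hrankOffset : s.natMem NatArray.rankOffset 0 = i)
    (hoffset : s.natMem NatArray.offset 0 = r * n + i) :
    rankLoop.wp ω (fun s' => s'.time ≤ s.time + (2 * L * 40 + 8) ∧
      s'.natMem NatArray.rank 0 = rank (s.sums · i) L (s.sums r i)) s := by
  refine wp_loop (fun k s' => s'.natMem NatArray.rankRep 0 = k ∧
      s'.natMem NatArray.rankOffset 0 = k * n + i ∧ s'.natMem NatArray.rank 0 =
        ((Finset.range k).filter fun r' => s.sums r i ≤ s.sums r' i).card)
    (2 * L) 40 ⟨hrep, by simpa using hrankOffset, by simpa using hrank⟩ ?_ ?_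
  · rintro k hk s' ⟨hrep', hrankOffset', hrank'⟩ hf
    refine ⟨by simpa +decide [hf.nat, hL, hrep', two_mul] using hk, wp_seq.2 ?_⟩
    have hnext : (k + 1) * n + i = k * n + i + n := by ring
    refine wp_ite (fun h => ?_) fun h => ?_
    · have h : s.sums r i ≤ s.sums k i := by
        simpa +decide [State.sums, hf.nat, hf.real, hrankOffset', hoffset] using h
      simp +decide [hf.nat, hrep', hrankOffset', hsize, hrank', Finset.range_add_one,
        Finset.filter_insert, h, hnext]
    · have h : ¬ s.sums r i ≤ s.sums k i := by
        simpa +decide [State.sums, hf.nat, hf.real, hrankOffset', hoffset] using h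
      simp +decide [hf.nat, hrep', hrankOffset', hsize, hrank', Finset.range_add_one,
        Finset.filter_insert, h, hnext]
  · rintro s' ⟨hrep', -, hrank'⟩ hf ht
    exact ⟨by simp +decide [hf.nat, hL, hrep', two_mul], by simpa [← add_assoc] using ht, hrank'⟩

theorem raiseOutput_spec {s : State M} {L : ℕ} {i : Fin n}
    (hL : s.natMem NatArray.digits 0 = L) (hpoint : s.natMem NatArray.point 0 = i) :
    raiseOutput.wp ω (fun s' => s'.time ≤ s.time + 25 ∧
      ∀ j, s'.realMem RealArray.output j = if j = i ∧ L ≤ s.natMem NatArray.rank 0 then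
          max (s.realMem RealArray.sums (s.natMem NatArray.offset 0))
            (s.realMem RealArray.output i)
        else s.realMem RealArray.output j) s := by
  refine wp_ite (fun h => wp_skip.2 ⟨by simp, fun j => ?_⟩) fun h =>
    wp_ite (fun h' => wp_setReal.2 ⟨by simp, fun j => ?_⟩)
      fun h' => wp_skip.2 ⟨by simp, fun j => ?_⟩
  · have h : ¬ L ≤ s.natMem NatArray.rank 0 := by simpa [hL] using h
    simp [h]
  · have h : L ≤ s.natMem NatArray.rank 0 := by simpa [hL] using h
    have h' : s.realMem RealArray.output i <
        s.realMem RealArray.sums (s.natMem NatArray.offset 0) := by simpa [hpoint] using h'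
    simp [h, hpoint, max_eq_left h'.le]
  · have h' : s.realMem RealArray.sums (s.natMem NatArray.offset 0) ≤
        s.realMem RealArray.output i := by simpa [hpoint] using h'
    by_cases hj : j = i <;> simp [hj, max_eq_right h']

theorem selectStep_spec {s : State M} {L r : ℕ} {i : Fin n}
    (hsize : s.natMem NatArray.size 0 = n) (hL : s.natMem NatArray.digits 0 = L)
    (hpoint : s.natMem NatArray.point 0 = i) (hoffset : s.natMem NatArray.offset 0 = r * n + i) :
    selectStep.wp ω (fun s' => s'.time ≤ s.time + (2 * L * 40 + 60) ∧
      s'.natMem NatArray.rep 0 = s.natMem NatArray.rep 0 + 1 ∧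
      s'.natMem NatArray.offset 0 = (r + 1) * n + i ∧
      ∀ j, s'.realMem RealArray.output j =
        if j = i ∧ L ≤ rank (s.sums · i) L (s.sums r i) then
          max (s.sums r i) (s.realMem RealArray.output i)
        else s.realMem RealArray.output j) s := by
  refine wp_seq.2 (wp_setNat.2 (wp_seq.2 (wp_setNat.2 (wp_seq.2 (wp_setNat.2 (wp_seq.2 ?_))))))
  refine (rankLoop_spec (L := L) (r := r) (i := i) (by simp [hsize]) (by simp [hL]) (by simp)
    (by simp) (by simp [hpoint]) (by simp [hoffset])).imp ?_
  rintro s₁ hf₁ ⟨htime₁, hrank₁⟩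
  refine wp_seq.2 ((raiseOutput_spec (L := L) (i := i) (by simp +decide [hf₁.nat, hL])
    (by simp +decide [hf₁.nat, hpoint])).imp ?_)
  rintro s₂ hf₂ ⟨htime₂, hout₂⟩
  refine wp_seq.2 (wp_setNat.2 (wp_setNat.2 ⟨?_, ?_, ?_, fun j => ?_⟩))
  · simp only [NExp.size, State.time_tick, State.time_writeNat] at htime₁ ⊢
    omega
  · simp +decide [hf₁.nat, hf₂.nat]
  · have hnext : (r + 1) * n + i = r * n + i + n := by ring
    simp +decide [hf₁.nat, hf₂.nat, hoffset, hsize, hnext]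
  · have hsum₁ : s₁.realMem RealArray.sums (s₁.natMem NatArray.offset 0) = s.sums r i := by
      simp +decide [hf₁.nat, hf₁.real, hoffset, State.sums]
    simp only [State.sums_tick, State.sums_writeNat] at hrank₁
    simp +decide [hout₂, hrank₁, hsum₁, hf₁.real]

theorem selectLoop_spec {s : State M} {L : ℕ} {i : Fin n}
    (hsize : s.natMem NatArray.size 0 = n) (hL : s.natMem NatArray.digits 0 = L)
    (hpoint : s.natMem NatArray.point 0 = i) (hrep : s.natMem NatArray.rep 0 = 0)
    (hoffset : s.natMem NatArray.offset 0 = i) (hout : s.realMem RealArray.output i = 0) :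
    selectLoop.wp ω (fun s' => s'.time ≤ s.time + (2 * L * (2 * L * 40 + 70) + 8) ∧
      ∀ j, s'.realMem RealArray.output j =
        if j = i then upperMedian (s.sums · i) L else s.realMem RealArray.output j) s := by
  refine wp_loop (fun k s' => s'.natMem NatArray.rep 0 = k ∧
      s'.natMem NatArray.offset 0 = k * n + i ∧
      ∀ j, s'.realMem RealArray.output j = if j = i then
        ((Finset.range k).filter fun r => L ≤ rank (s.sums · i) L (s.sums r i)).fold max 0
          (s.sums · i) else s.realMem RealArray.output j)
    (2 * L) (2 * L * 40 + 70) ⟨hrep, by simpa using hoffset, fun j => ?_⟩ ?_ ?_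
  · by_cases hj : j = i <;> simp [hj, hout]
  · rintro k hk s' ⟨hrep', hoffset', hout'⟩ hf
    have hsums' : s'.sums = s.sums := by
      funext r i
      exact hf.real _ rfl _
    refine ⟨by simpa +decide [hf.nat, hL, hrep', two_mul] using hk, ?_⟩
    refine (selectStep_spec (L := L) (r := k) (i := i) (by simp +decide [hf.nat, hsize])
      (by simp +decide [hf.nat, hL]) (by simp +decide [hf.nat, hpoint])
      (by simpa using hoffset')).imp ?_
    rintro s'' - ⟨htime'', hrep'', hoffset'', hout''⟩
    simp only [Test.size, NExp.size, State.time_tick] at htime''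
    refine ⟨by omega, by simpa [hrep'] using hrep'', hoffset'', fun j => ?_⟩
    simp only [hout'', State.sums_tick, State.realMem_tick, hsums', hout', if_true,
      Finset.range_add_one, Finset.filter_insert]
    by_cases hj : j = i <;>
      by_cases hr : L ≤ rank (s.sums · i) L (s.sums k i) <;>
        simp [hj, hr, Finset.fold_insert]
  · rintro s' ⟨hrep', -, hout'⟩ hf ht
    exact ⟨by simp +decide [hf.nat, hL, hrep', two_mul], by simpa [← add_assoc] using ht, hout'⟩

theorem outLoop_spec {s : State M} {L : ℕ}
    (hsize : s.natMem NatArray.size 0 = n) (hL : s.natMem NatArray.digits 0 = L)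
    (hpoint : s.natMem NatArray.point 0 = 0) (hout : ∀ i, s.realMem RealArray.output i = 0) :
    outLoop.wp ω (fun s' => s'.time ≤ s.time + (n * (2 * L * (2 * L * 40 + 70) + 40) + 5) ∧
      ∀ i : Fin n, s'.realMem RealArray.output i = upperMedian (s.sums · i) L) s := by
  refine wp_loop (fun k s' => s'.natMem NatArray.point 0 = k ∧
      ∀ i : Fin n, s'.realMem RealArray.output i =
        if i < k then upperMedian (s.sums · i) L else 0)
    n (2 * L * (2 * L * 40 + 70) + 40) ⟨hpoint, by simp [hout]⟩ ?_ ?_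
  · rintro k hk s' ⟨hpoint', hout'⟩ hf
    have hsums' : s'.sums = s.sums := by
      funext r i
      exact hf.real _ rfl _
    refine ⟨by simp +decide [hf.nat, hsize, hpoint', hk], ?_⟩
    refine wp_seq.2 (wp_setNat.2 (wp_seq.2 (wp_setNat.2 (wp_seq.2 ?_))))
    refine (selectLoop_spec (L := L) (i := ⟨k, hk⟩) (by simp +decide [hf.nat, hsize])
      (by simp +decide [hf.nat, hL]) (by simp [hpoint']) (by simp) (by simp [hpoint'])
      (by simpa using hout' ⟨k, hk⟩)).imp ?_
    rintro s'' hf' ⟨htime'', hout''⟩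
    refine wp_setNat.2 ⟨?_, ?_, fun i => ?_⟩
    · simp only [NExp.size, Test.size, State.time_tick, State.time_writeNat] at htime'' ⊢
      omega
    · simp +decide [hf'.nat, hpoint']
    · simp only [State.realMem_tick, State.realMem_writeNat, hout'', hout', State.sums_tick,
        State.sums_writeNat, hsums']
      rcases lt_trichotomy (i : ℕ) k with h | h | h
      · simp [h, h.ne, Nat.lt_succ_of_lt h]
      · obtain rfl : i = ⟨k, hk⟩ := Fin.ext h
        simp
      · simp [h.not_gt, h.ne', (Nat.succ_le_of_lt h).not_gt]
  · rintro s' ⟨hpoint', hout'⟩ hf ht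
    exact ⟨by simp +decide [hf.nat, hsize, hpoint'], by simpa [← add_assoc] using ht,
      fun i => by simp [hout']⟩

theorem depthLoop_spec {s : State M} {t : ℝ} (ht : 0 < t)
    (hsize : s.natMem NatArray.size 0 = n) (hL : s.natMem NatArray.digits 0 = 1)
    (hscale : s.realMem RealArray.scale 0 = 1)
    (hparams : s.realMem RealArray.params 0 * s.realMem RealArray.params 1 = t) :
    depthLoop.wp ω (fun s' => s'.time ≤ s.time + (depth n t * 40 + 12) ∧
      s'.natMem NatArray.digits 0 = depth n t + 1) s := by
  refine wp_loop (fun k s' => s'.natMem NatArray.digits 0 = k + 1 ∧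
      s'.realMem RealArray.scale 0 = (1 / 2) ^ k) (depth n t) 40 ⟨hL, by simpa using hscale⟩ ?_ ?_
  · rintro k hk s' ⟨hL', hscale'⟩ hf
    refine ⟨?_, wp_seq.2 (wp_setReal.2 (wp_setNat.2 ⟨by simp, by simp [hL'], ?_⟩))⟩
    · have : t < n * (1 / 2) ^ k := not_le.1 fun h => hk.not_ge ((mul_half_pow_le_iff ht).1 h)
      simpa +decide [hf.nat, hf.real, hsize, hscale', hparams] using this
    · simp [hscale', pow_succ, div_eq_mul_inv]
  · rintro s' ⟨hL', hscale'⟩ hf htime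
    have : n * (1 / 2) ^ depth n t ≤ t := (mul_half_pow_le_iff ht).2 le_rfl
    exact ⟨by simpa +decide [hf.nat, hf.real, hsize, hscale', hparams] using this,
      by simpa [← add_assoc] using htime, hL'⟩

theorem sizeLoop_spec {s : State M} {ε τ : ℝ} (hN : s.natMem NatArray.samples 0 = 0)
    (hε : s.realMem RealArray.params 0 = ε) (hτ : s.realMem RealArray.params 1 = τ) :
    sizeLoop.wp ω (fun s' => s'.time ≤ s.time + (sampleSize M.bound ε τ * 40 + 20) ∧
      s'.natMem NatArray.samples 0 = sampleSize M.bound ε τ) s := by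
  refine wp_loop (fun k s' => s'.natMem NatArray.samples 0 = k) (sampleSize M.bound ε τ) 40 hN ?_ ?_
  · rintro k hk s' hN' hf
    have := Nat.lt_ceil.1 hk
    exact ⟨by simpa [hf.real _ rfl, hN', hε, hτ] using this, by simp [hN']⟩
  · rintro s' hN' hf ht
    have := Nat.le_ceil (16 * (1 + M.bound (ε * τ)) / (ε * ε))
    refine ⟨by simpa [hf.real _ rfl, hN', hε, hτ, sampleSize] using this, ?_, hN'⟩
    simp only [Test.size, RExp.size, NExp.size, State.time_tick]
    omega

/-- The sum that repetition `r` has collected at point `i` when the program is finished. -/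
noncomputable def repetition (M : Env.{u, v, w} E n) (ω : ℕ → M.fam.Fn × unitInterval)
    (z : Fin n → ℝ) (L N r : ℕ) (i : Fin n) : ℝ :=
  ∑ b ∈ Finset.range L, levelSum M ω z L N b r i

theorem program_spec (z : Fin n → ℝ) {ε τ : ℝ} (ht : 0 < ε * τ) :
    let L := depth n (ε * τ) + 1
    let N := sampleSize M.bound ε τ
    program.wp ω (fun s => s.time ≤ L * (n * 40 +
        2 * L * (N * (n * (M.cost + 40) + M.cost * n + 40) + 40) + 110) + N * 40 +
        n * (2 * L * (2 * L * 40 + 70) + 40) + 20 ∧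
      ∀ i, output s i = upperMedian (repetition M ω z L N · i) L) (initState M z ε τ) := by
  intro L N
  refine wp_seq.2 (wp_setNat.2 (wp_seq.2 (wp_setReal.2 (wp_seq.2 ?_))))
  refine (depthLoop_spec ht (by simp [initState]) (by simp) (by simp)
    (by simp [initState])).imp ?_
  rintro s₁ hf₁ ⟨htime₁, hL₁⟩
  refine wp_seq.2 ((sizeLoop_spec (ε := ε) (τ := τ) (by simp +decide [hf₁.nat, initState])
    (by simp +decide [hf₁.real, initState]) (by simp +decide [hf₁.real, initState])).imp ?_)
  rintro s₂ hf₂ ⟨htime₂, hN₂⟩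
  have hg : s₂.Drawn 0 := hf₂.drawn (hf₁.drawn ⟨by simp [initState], rfl, by simp [initState]⟩
    rfl rfl) rfl rfl
  refine wp_seq.2 (wp_setReal.2 (wp_seq.2 ?_))
  refine (levelLoop_spec (z := z) (L := L) (N := N)
    (by simp +decide [hf₁.nat, hf₂.nat, initState]) (by simp +decide [hf₂.nat, hL₁, L])
    (by simp [hN₂, N]) (by simp +decide [hf₁.nat, hf₂.nat, initState]) (by simpa using hg)
    (by simp) (by simp +decide [hf₁.real, hf₂.real, initState])
    (by simp +decide [State.sums, hf₁.real, hf₂.real, initState])).imp ?_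
  rintro s₃ hf₃ ⟨htime₃, hsums₃⟩
  refine wp_seq.2 (wp_setNat.2 ?_)
  refine (outLoop_spec (L := L) (by simp +decide [hf₁.nat, hf₂.nat, hf₃.nat, initState])
    (by simp +decide [hf₂.nat, hf₃.nat, hL₁, L]) (by simp)
    (by simp +decide [hf₁.real, hf₂.real, hf₃.real, initState])).imp ?_
  rintro s₄ - ⟨htime₄, hout₄⟩
  refine ⟨?_, fun i => (hout₄ i).trans
    (upperMedian_congr fun r hr => by simpa [repetition] using hsums₃ r hr i)⟩
  have hinit : (initState M z ε τ).time = 0 := rfl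
  simp only [NExp.size, RExp.size, State.time_tick, State.time_writeNat, State.time_writeReal]
    at htime₁ htime₃ htime₄
  have : depth n (ε * τ) * 40 + 40 = L * 40 := by ring
  rw [show ∀ X, L * (X + 110) = L * (X + 70) + L * 40 from fun X => by ring]
  omega

end Specs

/-! ### Concentration of the estimates -/

section Independence

variable {Ω : Type*} [MeasurableSpace Ω] {P : Measure Ω}

/-- The converse of `iIndepFun_uncurry`. -/
theorem iIndepFun_curry {ι : Type*} {κ : ι → Type*} {β : (i : ι) → κ i → Type*}
    [∀ i j, MeasurableSpace (β i j)] {X : (i : ι) → (j : κ i) → Ω → β i j}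
    (hX : ∀ i j, Measurable (X i j))
    (h : iIndepFun (fun (p : (i : ι) × κ i) => X p.1 p.2) P) :
    iIndepFun (fun i ω j => X i j ω) P := by
  have := h.isProbabilityMeasure
  have (i : ι) (j : κ i) : IsProbabilityMeasure (P.map (X i j)) :=
    Measure.isProbabilityMeasure_map (hX i j).aemeasurable
  have hrow (i : ι) :
      P.map (fun ω j => X i j ω) = Measure.infinitePi fun j => P.map (X i j) :=
    (iIndepFun_iff_map_fun_eq_infinitePi_map (hX i)).1
      (h.precomp (g := Sigma.mk i) sigma_mk_injective)
  rw [iIndepFun_iff_map_fun_eq_infinitePi_map (by fun_prop)]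
  simp_rw [hrow]
  rw [← Measure.infinitePi_map_piCurry, ← (iIndepFun_iff_map_fun_eq_infinitePi_map
    fun p => hX p.1 p.2).1 h, Measure.map_map (by fun_prop) (by fun_prop)]
  rfl

open Classical in
theorem measure_card_le_two_mul_card_le {ι : Type*} [Fintype ι] [IsProbabilityMeasure P]
    {A : ι → Set Ω} (hA : iIndepSet A P) {p : ENNReal} (hp : p ≤ 1)
    (hAp : ∀ i, P (A i) ≤ p ^ 2) :
    P {ω | Fintype.card ι ≤ 2 * (Finset.univ.filter fun i => ω ∈ A i).card} ≤
      (2 * p) ^ Fintype.card ι := by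
  have hall (T : Finset ι) (hT : Fintype.card ι ≤ 2 * T.card) :
      P (⋂ i ∈ T, A i) ≤ p ^ Fintype.card ι := calc
    P (⋂ i ∈ T, A i) = ∏ i ∈ T, P (A i) := hA.meas_biInter T
    _ ≤ ∏ _i ∈ T, p ^ 2 := Finset.prod_le_prod' fun i _ => hAp i
    _ = p ^ (2 * T.card) := by rw [Finset.prod_const, ← pow_mul]
    _ ≤ p ^ Fintype.card ι := pow_le_pow_right_of_le_one' hp hT
  set large := Finset.univ.filter fun T : Finset ι => Fintype.card ι ≤ 2 * T.card
  calc P {ω | Fintype.card ι ≤ 2 * (Finset.univ.filter fun i => ω ∈ A i).card}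
      ≤ P (⋃ T ∈ large, ⋂ i ∈ T, A i) := measure_mono fun ω hω => by
        refine Set.mem_biUnion (x := Finset.univ.filter fun i => ω ∈ A i)
          (Finset.mem_coe.2 (Finset.mem_filter.2 ⟨Finset.mem_univ _, hω⟩)) ?_
        exact Set.mem_iInter₂.2 fun i hi => (Finset.mem_filter.1 hi).2
    _ ≤ ∑ T ∈ large, P (⋂ i ∈ T, A i) := measure_biUnion_finset_le _ _
    _ ≤ large.card • p ^ Fintype.card ι :=
        Finset.sum_le_card_nsmul _ _ _ fun T hT => hall T (Finset.mem_filter.1 hT).2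
    _ ≤ 2 ^ Fintype.card ι * p ^ Fintype.card ι := by
        rw [nsmul_eq_mul]
        gcongr
        exact_mod_cast (Finset.card_filter_le _ _).trans_eq (by simp)
    _ = (2 * p) ^ Fintype.card ι := (mul_pow _ _ _).symm

end Independence

namespace HashFamily

variable {E : Type w} (F : HashFamily.{u, v, w} E) {ι : Type*}

instance : IsProbabilityMeasure F.tapeLaw := by
  unfold tapeLaw
  infer_instance

theorem measurePreserving_fst_snd {a b : ℕ} (hab : a ≠ b) :
    MeasurePreserving (fun ω : ℕ → F.Fn × unitInterval => ((ω a).1, (ω b).2)) F.tapeLaw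
      (F.law.prod volume) := by
  refine ⟨by fun_prop, ?_⟩
  change F.tapeLaw.map (Prod.map Prod.fst Prod.snd ∘ fun ω => (ω a, ω b)) = _
  rw [← Measure.map_map (by fun_prop) (by fun_prop), tapeLaw,
    Measure.infinitePi_map_eval_prod hab, ← Measure.map_prod_map _ _ measurable_fst measurable_snd]
  simp only [Measure.map_fst_prod, Measure.map_snd_prod, measure_univ, one_smul]

theorem cell_map (pt : ι → E) (S : List ι) (h : F.Fn) (q : E) :
    F.cell id (S.map pt) h q = (F.cell pt S h q).map pt := by
  simp only [cell, List.filter_map]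
  rfl

theorem estimate_map (k : E → E → ℝ) (pt : ι → E) (S : List ι) (h : F.Fn) (r : unitInterval)
    (q : E) : F.estimate k id (S.map pt) h r q = F.estimate k pt S h r q := by
  simp only [estimate, draw, cell_map, List.length_map, List.getElem?_map]
  cases (F.cell pt S h q)[⌊(r : ℝ) * (F.cell pt S h q).length⌋₊]? <;> rfl

theorem estimate_nil (k : E → E → ℝ) (pt : ι → E) (h : F.Fn) (r : unitInterval) (q : E) :
    F.estimate k pt [] h r q = 0 := by
  simp only [estimate, draw, cell, List.filter_nil, List.getElem?_nil, Option.elim_none]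

/-- The estimate depends on the hash function only through the set of labels that collide with the
query, which takes finitely many values. -/
theorem measurable_estimate [Finite ι] (k : E → E → ℝ) (pt : ι → E) (S : List ι) (q : E) :
    Measurable fun ω : F.Fn × unitInterval => F.estimate k pt S ω.1 ω.2 q := by
  classical
  let cell (A : Set ι) : List ι := S.filter (· ∈ A)
  let value (A : Set ι) (l : ℕ) : ℝ := (cell A)[l]?.elim 0 fun j =>
    k q (pt j) / F.collisionProb q (pt j) * ((cell A).length / S.length)
  have hvalue : Measurable fun p : Set ι × unitInterval =>
      value p.1 ⌊(p.2 : ℝ) * (cell p.1).length⌋₊ :=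
    measurable_from_prod_countable_right fun A => (measurable_from_nat (f := value A)).comp
      (Nat.measurable_floor.comp (measurable_subtype_coe.mul_const ((cell A).length : ℝ)))
  have hcollide : Measurable fun h : F.Fn => {j : ι | F.hash h (pt j) = F.hash h q} :=
    measurable_set_iff.2 fun j => measurable_to_prop <| by
      convert F.measurableSet_collision (pt j) q using 1
      ext h
      simp only [Set.mem_preimage, Set.mem_singleton_iff, eq_iff_iff, iff_true, Set.mem_ofPred_eq]
  exact hvalue.comp ((hcollide.comp measurable_fst).prodMk measurable_snd)

theorem abs_estimate_le [Fintype ι] (k : E → E → ℝ) (pt : ι → E) (S : List ι) (h : F.Fn)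
    (r : unitInterval) (q : E) :
    |F.estimate k pt S h r q| ≤ ∑ j, |k q (pt j) / F.collisionProb q (pt j)| := by
  unfold estimate
  rcases F.draw pt S h r q with _ | j
  · simpa only [Option.elim_none, abs_zero] using Finset.sum_nonneg fun _ _ => abs_nonneg _
  · have hfrac : |((F.cell pt S h q).length : ℝ) / S.length| ≤ 1 := by
      rw [abs_of_nonneg (by positivity)]
      exact div_le_one_of_le₀ (by exact_mod_cast List.length_filter_le _ _) (by positivity)
    rw [Option.elim_some, abs_mul]
    exact (mul_le_of_le_one_right (abs_nonneg _) hfrac).trans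
      (Finset.single_le_sum (f := fun j => |k q (pt j) / F.collisionProb q (pt j)|)
        (fun _ _ => abs_nonneg _) (Finset.mem_univ j))

theorem memLp_estimate [Finite ι] (k : E → E → ℝ) (pt : ι → E) (S : List ι) (q : E) :
    MemLp (fun ω : F.Fn × unitInterval => F.estimate k pt S ω.1 ω.2 q) 2
      (F.law.prod (volume : Measure unitInterval)) :=
  have := Fintype.ofFinite ι
  MemLp.of_bound (F.measurable_estimate k pt S q).aestronglyMeasurable _
    (.of_forall fun ω => (Real.norm_eq_abs _).trans_le (F.abs_estimate_le k pt S ω.1 ω.2 q))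

end HashFamily

theorem length_mul_density {E : Type w} (k : E → E → ℝ) (S : List E) (q : E) :
    S.length * density k S q = (S.map (k q)).sum := by
  rcases eq_or_ne S [] with rfl | hS
  · simp only [List.length_nil, Nat.cast_zero, zero_mul, List.map_nil, List.sum_nil]
  · exact mul_div_cancel₀ _ (by simpa only [ne_eq, Nat.cast_eq_zero, List.length_eq_zero_iff])

theorem density_mem_Icc {E : Type w} {k : E → E → ℝ} {S : List E} {q : E}
    (hk : ∀ y ∈ S, k q y ∈ Set.Icc (0 : ℝ) 1) : density k S q ∈ Set.Icc (0 : ℝ) 1 := by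
  have hk' (a : ℝ) (ha : a ∈ S.map (k q)) : a ∈ Set.Icc (0 : ℝ) 1 := by
    obtain ⟨y, hy, rfl⟩ := List.mem_map.1 ha
    exact hk y hy
  refine ⟨div_nonneg (List.sum_nonneg fun a ha => (hk' a ha).1) (Nat.cast_nonneg _),
    div_le_one_of_le₀ ?_ (Nat.cast_nonneg _)⟩
  simpa using List.sum_le_card_nsmul _ 1 fun a ha => (hk' a ha).2

theorem VBounded.sq_mul_le {E : Type w} [PseudoMetricSpace E] {F : HashFamily.{u, v, w} E}
    {k : E → E → ℝ} {V : ℝ → ℝ} {R : ℝ} {n : ℕ} (hV : VBounded F k V R n) {q t : ℝ}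
    (hq : q ∈ Set.Icc (0 : ℝ) 1) (ht : t ∈ Set.Ioc (0 : ℝ) 1) :
    q ^ 2 * V q ≤ (q ^ 2 + t ^ 2) * V t := by
  have hVt := hV.nonneg t ht
  rcases hq.1.eq_or_lt with rfl | hq0
  · rw [zero_pow two_ne_zero, zero_mul]
    positivity
  rcases le_total t q with htq | hqt
  · calc q ^ 2 * V q ≤ q ^ 2 * V t := by gcongr; exact hV.antitone ht ⟨hq0, hq.2⟩ htq
      _ ≤ (q ^ 2 + t ^ 2) * V t := by gcongr; linarith [sq_nonneg t]
  · calc q ^ 2 * V q ≤ t ^ 2 * V t := hV.monotone ⟨hq0, hq.2⟩ ht hqt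
      _ ≤ (q ^ 2 + t ^ 2) * V t := by gcongr; linarith [sq_nonneg q]

section Digits

theorem residual_nonneg {x : ℝ} (hx : 0 ≤ x) (b : ℕ) : 0 ≤ residual x b := by
  induction b with
  | zero => exact hx
  | succ b ih =>
    rw [residual]
    split_ifs with h
    exacts [sub_nonneg.2 h, ih]

theorem residual_le {x : ℝ} (hx : x ≤ 1) (b : ℕ) : residual x (b + 1) ≤ (1 / 2) ^ b := by
  induction b with
  | zero =>
    simp only [residual, pow_zero]
    split_ifs <;> linarith
  | succ b ih =>
    rw [residual]
    split_ifs with h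
    · have hhalf : (1 / 2 : ℝ) ^ b = 2 * (1 / 2) ^ (b + 1) := by ring
      linarith
    · exact (not_le.1 h).le

/-- The binary digit of `x` at place `(1 / 2) ^ b`, multiplied by `(1 / 2) ^ b`. -/
noncomputable def digit (x : ℝ) (b : ℕ) : ℝ :=
  if (1 / 2) ^ b ≤ residual x b then (1 / 2) ^ b else 0

theorem digit_nonneg (x : ℝ) (b : ℕ) : 0 ≤ digit x b := by
  unfold digit
  split_ifs <;> positivity

theorem residual_add_sum_digit (x : ℝ) (L : ℕ) :
    residual x L + ∑ b ∈ Finset.range L, digit x b = x := by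
  induction L with
  | zero => simp only [residual, Finset.range_zero, Finset.sum_empty, add_zero]
  | succ L ih =>
    rw [Finset.sum_range_succ, residual, digit]
    split_ifs <;> linarith

theorem half_pow_mul_sum_level {n : ℕ} (z φ : Fin n → ℝ) (b : ℕ) :
    (1 / 2) ^ b * ((level z b).map φ).sum = ∑ j, φ j * digit (z j) b := by
  have hsum := List.sum_map_ite (fun j => (1 / 2) ^ b ≤ residual (z j) b) φ (fun _ => 0)
    (List.finRange n)
  simp only [List.map_const', List.sum_replicate, smul_zero, add_zero] at hsum
  rw [level, ← hsum, ← Fin.sum_univ_def, Finset.mul_sum]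
  refine Finset.sum_congr rfl fun j _ => ?_
  rw [digit]
  split_ifs <;> ring

end Digits

namespace Env

variable {E : Type w} {n : ℕ} (M : Env.{u, v, w} E n)

/-- The kernel matrix of the dataset. -/
def kernelMatrix : Matrix (Fin n) (Fin n) ℝ := Matrix.of fun i j => M.ker (M.pt i) (M.pt j)

/-- The assumptions on the estimator and on the dataset under which the program is analysed: the
estimator is `V`-bounded with `V = M.bound`, and the dataset consists of distinct points, has
diameter at most `R`, and has kernel values in `[0, 1]`. -/
structure Admissible [PseudoMetricSpace E] (R : ℝ) : Prop where
  vBounded : VBounded M.fam M.ker M.bound R n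
  ker_mem : ∀ i j, M.ker (M.pt i) (M.pt j) ∈ Set.Icc (0 : ℝ) 1
  injective : Function.Injective M.pt
  diam_le : Metric.diam (Set.range M.pt) ≤ R

end Env

section Answer

variable {E : Type w} {n : ℕ} {M : Env.{u, v, w} E n}

theorem tapePositions_ne (g : ℕ) (i : Fin n) : g * (n + 1) ≠ g * (n + 1) + 1 + i := by omega

theorem measurable_answer (S : List (Fin n)) (g : ℕ) (i : Fin n) :
    Measurable fun ω => answer M ω S g i :=
  (M.fam.measurable_estimate M.ker M.pt S (M.pt i)).comp
    (M.fam.measurePreserving_fst_snd (tapePositions_ne g i)).measurable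

theorem memLp_answer (S : List (Fin n)) (g : ℕ) (i : Fin n) :
    MemLp (fun ω => answer M ω S g i) 2 M.fam.tapeLaw :=
  (M.fam.memLp_estimate M.ker M.pt S (M.pt i)).comp_measurePreserving
    (M.fam.measurePreserving_fst_snd (tapePositions_ne g i))

theorem integral_comp_answer {φ : ℝ → ℝ} (hφ : Measurable φ) (S : List (Fin n)) (g : ℕ)
    (i : Fin n) :
    ∫ ω, φ (answer M ω S g i) ∂M.fam.tapeLaw =
      ∫ ω, φ (M.fam.estimate M.ker M.pt S ω.1 ω.2 (M.pt i)) ∂(M.fam.law.prod volume) := by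
  have hpres := M.fam.measurePreserving_fst_snd (tapePositions_ne g i)
  have hmeas := hφ.comp (M.fam.measurable_estimate M.ker M.pt S (M.pt i))
  have hmap := integral_map (μ := M.fam.tapeLaw) hpres.measurable.aemeasurable
    hmeas.aestronglyMeasurable
  rw [hpres.map_eq] at hmap
  exact hmap.symm

theorem iIndepFun_answer {κ : Type*} (S : κ → List (Fin n)) {g : κ → ℕ}
    (hg : Function.Injective g) (i : Fin n) :
    iIndepFun (fun k ω => answer M ω (S k) (g k) i) M.fam.tapeLaw := by
  have htape : iIndepFun (fun j (ω : ℕ → M.fam.Fn × unitInterval) => ω j) M.fam.tapeLaw :=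
    iIndepFun_infinitePi (X := fun _ ω => ω) fun _ => measurable_id
  have hinj : Function.Injective fun p : (_ : κ) × Bool =>
      g p.1 * (n + 1) + (cond p.2 i.succ 0 : Fin (n + 1)) := by
    rintro ⟨k, b⟩ ⟨k', b'⟩ h
    obtain ⟨hk, hb⟩ := mul_add_fin_inj.1 h
    obtain rfl := hg hk
    cases b <;> cases b' <;> simp_all [Fin.succ_ne_zero, (Fin.succ_ne_zero _).symm]
  have hblocks := (iIndepFun_curry (X := fun k c (ω : ℕ → M.fam.Fn × unitInterval) =>
    ω (g k * (n + 1) + (cond c i.succ 0 : Fin (n + 1)))) (by fun_prop) (htape.precomp hinj)).comp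
    (fun k (u : Bool → M.fam.Fn × unitInterval) =>
      M.fam.estimate M.ker M.pt (S k) (u false).1 (u true).2 (M.pt i))
    fun k => (M.fam.measurable_estimate M.ker M.pt (S k) (M.pt i)).comp
      (f := fun u : Bool → M.fam.Fn × unitInterval => ((u false).1, (u true).2)) (by fun_prop)
  convert hblocks using 3 with k ω
  simp [answer, add_assoc, add_comm]

variable [PseudoMetricSpace E] {R : ℝ} {S : List (Fin n)}

theorem Env.Admissible.diam_insert_le (hM : M.Admissible R) (S : List (Fin n)) (i : Fin n) :
    Metric.diam (insert (M.pt i) {y | y ∈ S.map M.pt}) ≤ R := by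
  refine (Metric.diam_mono ?_ (Set.finite_range M.pt).isBounded).trans hM.diam_le
  rintro y (rfl | hy)
  · exact ⟨i, rfl⟩
  · obtain ⟨j, -, rfl⟩ := List.mem_map.1 hy
    exact ⟨j, rfl⟩

theorem integral_answer (hM : M.Admissible R) (hS : S.Nodup) (g : ℕ) (i : Fin n) :
    ∫ ω, answer M ω S g i ∂M.fam.tapeLaw = density M.ker (S.map M.pt) (M.pt i) := by
  refine (integral_comp_answer (φ := fun x => x) measurable_id S g i).trans ?_
  rcases eq_or_ne S [] with rfl | hne
  · simp [M.fam.estimate_nil, density]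
  · rw [← hM.vBounded.unbiased (S.map M.pt) (by simpa) (hS.map hM.injective)
      (by simpa using hS.length_le_card.trans_eq (Fintype.card_fin n)) _ (hM.diam_insert_le S i)]
    simp only [M.fam.estimate_map]

theorem variance_answer_le (hM : M.Admissible R) (hS : S.Nodup) (g : ℕ) (i : Fin n) {t : ℝ}
    (ht : t ∈ Set.Ioc (0 : ℝ) 1) :
    Var[fun ω => answer M ω S g i; M.fam.tapeLaw] ≤
      (density M.ker (S.map M.pt) (M.pt i) ^ 2 + t ^ 2) * M.bound t := by
  refine (variance_le_expectation_sq (memLp_answer S g i).aestronglyMeasurable).trans ?_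
  have hsq := integral_comp_answer (M := M) (φ := (· ^ 2)) (by fun_prop) S g i
  refine hsq.trans_le ?_
  rcases eq_or_ne S [] with rfl | hne
  · have := hM.vBounded.nonneg t ht
    simp only [M.fam.estimate_nil, zero_pow two_ne_zero, integral_zero]
    positivity
  · refine le_trans ?_ (hM.vBounded.sq_mul_le (density_mem_Icc ?_) ht)
    · simpa only [M.fam.estimate_map] using hM.vBounded.second_moment (S.map M.pt) (by simpa)
        (hS.map hM.injective) (by simpa using hS.length_le_card.trans_eq (Fintype.card_fin n)) _
        (hM.diam_insert_le S i)
    · intro y hy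
      obtain ⟨j, -, rfl⟩ := List.mem_map.1 hy
      exact hM.ker_mem i j

end Answer

section Truncation

variable {E : Type w} {n : ℕ}

/-- The vector `z` with its entries cut off after `L` binary digits. -/
noncomputable def truncation (z : Fin n → ℝ) (L : ℕ) (j : Fin n) : ℝ :=
  ∑ b ∈ Finset.range L, digit (z j) b

theorem truncation_nonneg (z : Fin n → ℝ) (L : ℕ) (j : Fin n) : 0 ≤ truncation z L j :=
  Finset.sum_nonneg fun b _ => digit_nonneg (z j) b

theorem truncation_le {z : Fin n → ℝ} (hz : ∀ j, 0 ≤ z j) (L : ℕ) (j : Fin n) :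
    truncation z L j ≤ z j :=
  le_of_add_le_of_nonneg_right (residual_add_sum_digit (z j) L).le (residual_nonneg (hz j) L)

theorem le_truncation_add {z : Fin n → ℝ} {j : Fin n} (hz : z j ≤ 1) (L : ℕ) :
    z j ≤ truncation z (L + 1) j + (1 / 2) ^ L := by
  rw [← residual_add_sum_digit (z j) (L + 1), add_comm]
  exact add_le_add_right (residual_le hz L) _

theorem nodup_level (z : Fin n → ℝ) (b : ℕ) : (level z b).Nodup :=
  (List.nodup_finRange n).filter _

theorem half_pow_mul_length_level (z : Fin n → ℝ) (b : ℕ) :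
    (1 / 2) ^ b * ((level z b).length : ℝ) = ∑ j, digit (z j) b := by
  simpa only [List.map_const', List.sum_replicate, nsmul_one, one_mul] using
    half_pow_mul_sum_level z (fun _ => 1) b

theorem half_pow_mul_length_mul_density (M : Env.{u, v, w} E n) (z : Fin n → ℝ) (b : ℕ)
    (i : Fin n) :
    (1 / 2) ^ b * ((level z b).length : ℝ) * density M.ker ((level z b).map M.pt) (M.pt i) =
      (M.kernelMatrix.mulVec fun j => digit (z j) b) i := by
  rw [mul_assoc, ← List.length_map M.pt, length_mul_density, List.map_map]
  exact half_pow_mul_sum_level z (M.kernelMatrix i) b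

theorem sum_mulVec_digit (M : Env.{u, v, w} E n) (z : Fin n → ℝ) (L : ℕ) (i : Fin n) :
    ∑ b ∈ Finset.range L, (M.kernelMatrix.mulVec fun j => digit (z j) b) i =
      M.kernelMatrix.mulVec (truncation z L) i := by
  simp only [Matrix.mulVec, dotProduct, truncation, Finset.mul_sum]
  exact Finset.sum_comm

end Truncation

section Moments

variable {E : Type w} {n : ℕ} {M : Env.{u, v, w} E n} {z : Fin n → ℝ} {L N : ℕ} {i : Fin n}

theorem memLp_levelSum (b r : ℕ) :
    MemLp (fun ω => levelSum M ω z L N b r i) 2 M.fam.tapeLaw :=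
  (memLp_finsetSum _ fun _ _ => memLp_answer _ _ i).const_mul _

theorem memLp_repetition (r : ℕ) :
    MemLp (fun ω => repetition M ω z L N r i) 2 M.fam.tapeLaw :=
  memLp_finsetSum _ fun b _ => memLp_levelSum b r

theorem measurable_levelSum (b r : ℕ) : Measurable fun ω => levelSum M ω z L N b r i :=
  (Finset.measurable_fun_sum _ fun _ _ => measurable_answer _ _ i).const_mul _

theorem measurable_repetition (r : ℕ) : Measurable fun ω => repetition M ω z L N r i :=
  Finset.measurable_fun_sum _ fun b _ => measurable_levelSum b r

theorem iIndepFun_levelSum :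
    iIndepFun (fun (p : (_ : Fin (2 * L)) × ℕ) ω => levelSum M ω z L N p.2 p.1 i)
      M.fam.tapeLaw := by
  have hinj : Function.Injective fun q : (_ : (_ : Fin (2 * L)) × ℕ) × Fin N =>
      q.1.2 * (2 * L * N) + q.1.1 * N + (q.2 : ℕ) := by
    rintro ⟨⟨r, b⟩, l⟩ ⟨⟨r', b'⟩, l'⟩ h
    simp only [← mul_assoc _ (2 * L) N, ← add_mul, mul_add_fin_inj] at h
    obtain ⟨⟨rfl, rfl⟩, rfl⟩ := h
    rfl
  have hanswer := iIndepFun_answer (M := M)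
    (fun q : (_ : (_ : Fin (2 * L)) × ℕ) × Fin N => level z q.1.2) hinj i
  have hmeas (p : (_ : Fin (2 * L)) × ℕ) (l : Fin N) : Measurable fun ω =>
      answer M ω (level z p.2) (p.2 * (2 * L * N) + p.1 * N + l) i := measurable_answer _ _ i
  simp only [levelSum, Finset.sum_range]
  exact (iIndepFun_curry hmeas hanswer).comp (fun p (a : Fin N → ℝ) =>
    (1 / 2) ^ p.2 * (level z p.2).length / N * ∑ l, a l) fun p => by fun_prop

theorem iIndepFun_repetition :
    iIndepFun (fun (r : Fin (2 * L)) ω => repetition M ω z L N r i) M.fam.tapeLaw :=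
  (iIndepFun_curry (fun (r : Fin (2 * L)) b => measurable_levelSum b r) iIndepFun_levelSum).comp
    (fun _ (a : ℕ → ℝ) => ∑ b ∈ Finset.range L, a b) fun _ => by fun_prop

variable [PseudoMetricSpace E] {R : ℝ}

theorem integral_levelSum (hM : M.Admissible R) (hN : N ≠ 0) (b r : ℕ) :
    ∫ ω, levelSum M ω z L N b r i ∂M.fam.tapeLaw =
      (M.kernelMatrix.mulVec fun j => digit (z j) b) i := by
  have hN' : (N : ℝ) ≠ 0 := Nat.cast_ne_zero.2 hN
  simp only [levelSum]
  rw [integral_const_mul,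
    integral_finsetSum _ fun l _ => (memLp_answer _ _ i).integrable one_le_two]
  simp only [integral_answer hM (nodup_level z b)]
  rw [Finset.sum_const, Finset.card_range, nsmul_eq_mul, ← half_pow_mul_length_mul_density]
  field_simp

theorem integral_repetition (hM : M.Admissible R) (hN : N ≠ 0) (r : ℕ) :
    ∫ ω, repetition M ω z L N r i ∂M.fam.tapeLaw =
      M.kernelMatrix.mulVec (truncation z L) i := by
  simp only [repetition]
  rw [integral_finsetSum _ fun b _ => (memLp_levelSum b r).integrable one_le_two,
    ← sum_mulVec_digit]
  exact Finset.sum_congr rfl fun b _ => integral_levelSum hM hN b r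

theorem variance_levelSum_le (hM : M.Admissible R) (b r : ℕ) {t : ℝ}
    (ht : t ∈ Set.Ioc (0 : ℝ) 1) :
    Var[fun ω => levelSum M ω z L N b r i; M.fam.tapeLaw] ≤
      ((M.kernelMatrix.mulVec fun j => digit (z j) b) i ^ 2 +
        ((∑ j, digit (z j) b) * t) ^ 2) * (M.bound t / N) := by
  have hindep : iIndepFun (fun l ω =>
      answer M ω (level z b) (b * (2 * L * N) + r * N + l) i) M.fam.tapeLaw :=
    iIndepFun_answer _ (add_right_injective _) i
  have hvar := IndepFun.variance_sum (s := Finset.range N)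
    (fun l _ => memLp_answer (level z b) (b * (2 * L * N) + r * N + l) i)
    fun l _ l' _ hl => hindep.indepFun hl
  simp only [levelSum]
  rw [variance_const_mul, ← Finset.sum_fn, hvar]
  calc _ ≤ ((1 / 2) ^ b * ((level z b).length : ℝ) / N) ^ 2 * ∑ _l ∈ Finset.range N,
        (density M.ker ((level z b).map M.pt) (M.pt i) ^ 2 + t ^ 2) * M.bound t := by
        gcongr
        exact variance_answer_le hM (nodup_level z b) _ _ ht
    _ = _ := by
        rw [Finset.sum_const, Finset.card_range, nsmul_eq_mul, ← half_pow_mul_length_mul_density,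
          ← half_pow_mul_length_level]
        rcases eq_or_ne N 0 with rfl | hN
        · simp only [Nat.cast_zero, div_zero, zero_mul, mul_zero]
        · field_simp

end Moments

section Concentration

variable {E : Type w} [PseudoMetricSpace E] {n : ℕ} {M : Env.{u, v, w} E n} {R : ℝ}
  {z : Fin n → ℝ} {i : Fin n} {t : ℝ}

theorem Env.Admissible.mulVec_nonneg (hM : M.Admissible R) {x : Fin n → ℝ} (hx : ∀ j, 0 ≤ x j)
    (i : Fin n) : 0 ≤ M.kernelMatrix.mulVec x i :=
  Fintype.sum_nonneg fun j => mul_nonneg (hM.ker_mem i j).1 (hx j)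

theorem variance_repetition_le (hM : M.Admissible R) (hz : ∀ j, 0 ≤ z j) (hz1 : ∑ j, z j ≤ 1)
    (ht : t ∈ Set.Ioc (0 : ℝ) 1) {L N : ℕ} (r : Fin (2 * L)) :
    Var[fun ω => repetition M ω z L N r i; M.fam.tapeLaw] ≤
      (M.kernelMatrix.mulVec (truncation z L) i + t) ^ 2 * (M.bound t / N) := by
  set value : ℕ → ℝ := fun b => (M.kernelMatrix.mulVec fun j => digit (z j) b) i
  set mass : ℕ → ℝ := fun b => ∑ j, digit (z j) b with hmass
  set y := M.kernelMatrix.mulVec (truncation z L) i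
  have hsum_value : ∑ b ∈ Finset.range L, value b = y := sum_mulVec_digit M z L i
  have hvalue_nonneg (b : ℕ) : 0 ≤ value b := hM.mulVec_nonneg (fun j => digit_nonneg (z j) b) i
  have hmass_nonneg (b : ℕ) : 0 ≤ mass b := Finset.sum_nonneg fun j _ => digit_nonneg (z j) b
  have hmass_le : ∑ b ∈ Finset.range L, mass b ≤ 1 := by
    rw [hmass, Finset.sum_comm]
    exact (Finset.sum_le_sum fun j _ => truncation_le hz L j).trans hz1
  have hsq_value : ∑ b ∈ Finset.range L, value b ^ 2 ≤ y ^ 2 :=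
    hsum_value ▸ Finset.sum_sq_le_sq_sum_of_nonneg fun b _ => hvalue_nonneg b
  have hsq_mass : ∑ b ∈ Finset.range L, mass b ^ 2 ≤ 1 :=
    (Finset.sum_sq_le_sq_sum_of_nonneg fun b _ => hmass_nonneg b).trans
      (pow_le_one₀ (Finset.sum_nonneg fun b _ => hmass_nonneg b) hmass_le)
  have hy_nonneg : 0 ≤ y := hM.mulVec_nonneg (truncation_nonneg z L) i
  have hVt := hM.vBounded.nonneg t ht
  have hindep : iIndepFun (fun b ω => levelSum M ω z L N b r i) M.fam.tapeLaw :=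
    iIndepFun_levelSum.precomp (g := Sigma.mk r) sigma_mk_injective
  have hvar := IndepFun.variance_sum (s := Finset.range L)
    (fun b _ => memLp_levelSum (M := M) (z := z) (L := L) (N := N) (i := i) b r)
    fun b _ b' _ hb => hindep.indepFun hb
  simp only [repetition]
  rw [← Finset.sum_fn, hvar]
  calc ∑ b ∈ Finset.range L, Var[fun ω => levelSum M ω z L N b r i; M.fam.tapeLaw]
      ≤ ∑ b ∈ Finset.range L, (value b ^ 2 + (mass b * t) ^ 2) * (M.bound t / N) :=
        Finset.sum_le_sum fun b _ => variance_levelSum_le hM b r ht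
    _ = (∑ b ∈ Finset.range L, value b ^ 2 + (∑ b ∈ Finset.range L, mass b ^ 2) * t ^ 2) *
        (M.bound t / N) := by
        simp only [mul_pow, ← Finset.sum_mul, Finset.sum_add_distrib]
    _ ≤ (y ^ 2 + 1 * t ^ 2) * (M.bound t / N) := by gcongr
    _ ≤ (y + t) ^ 2 * (M.bound t / N) := by
        gcongr
        linarith [mul_nonneg hy_nonneg ht.1.le, add_sq y t]

theorem measure_repetition_le (hM : M.Admissible R) (hz : ∀ j, 0 ≤ z j) (hz1 : ∑ j, z j ≤ 1)
    (ht : t ∈ Set.Ioc (0 : ℝ) 1) {ε : ℝ} (hε : 0 < ε) {L N : ℕ} (hN : N ≠ 0)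
    (hbound : 16 * M.bound t ≤ N * ε ^ 2) (r : Fin (2 * L)) :
    M.fam.tapeLaw {ω | ε * (M.kernelMatrix.mulVec (truncation z L) i + t) <
      |repetition M ω z L N r i - M.kernelMatrix.mulVec (truncation z L) i|} ≤ (1 / 4) ^ 2 := by
  set y := M.kernelMatrix.mulVec (truncation z L) i
  have hy : 0 < y + t := add_pos_of_nonneg_of_pos (hM.mulVec_nonneg (truncation_nonneg z L) i) ht.1
  have hN' : (0 : ℝ) < N := by positivity
  have hcheb := meas_ge_le_variance_div_sq (memLp_repetition (M := M) (z := z) (L := L) (N := N)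
    (i := i) r) (mul_pos hε hy)
  rw [integral_repetition hM hN] at hcheb
  have hsixteenth : Var[fun ω => repetition M ω z L N r i; M.fam.tapeLaw] / (ε * (y + t)) ^ 2 ≤
      (1 / 4) ^ 2 := by
    rw [div_le_iff₀ (by positivity)]
    calc _ ≤ (y + t) ^ 2 * (M.bound t / N) := variance_repetition_le hM hz hz1 ht r
      _ ≤ (y + t) ^ 2 * (ε ^ 2 / 16) := by
        gcongr ?_ * ?_
        rw [div_le_div_iff₀ hN' (by norm_num)]
        linarith
      _ = (1 / 4) ^ 2 * (ε * (y + t)) ^ 2 := by ring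
  refine (measure_mono ?_).trans ((hcheb.trans (ENNReal.ofReal_le_ofReal hsixteenth)).trans_eq ?_)
  · exact Set.ofPred_subset_ofPred.2 fun ω => le_of_lt
  rw [ENNReal.ofReal_pow (by norm_num), ENNReal.ofReal_div_of_pos (by norm_num)]
  norm_num

end Concentration

section Median

variable {L : ℕ}

theorem abs_upperMedian_sub_le {a : ℕ → ℝ} {y δ : ℝ} (hy : 0 ≤ y) (hδ : 0 ≤ δ)
    (hbad : ((Finset.range (2 * L)).filter fun r => δ < |a r - y|).card < L) :
    |upperMedian a L - y| ≤ δ := by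
  have hfew {p : ℕ → Prop} [DecidablePred p] (hp : ∀ r, p r → δ < |a r - y|) :
      ((Finset.range (2 * L)).filter p).card < L :=
    (Finset.card_le_card (Finset.monotone_filter_right _ fun r _ => hp r)).trans_lt hbad
  have hupper : upperMedian a L ≤ y + δ := by
    refine (Finset.fold_max_le _).2 ⟨add_nonneg hy hδ, fun r hr => ?_⟩
    by_contra! har
    exact (Finset.mem_filter.1 hr).2.not_gt
      (hfew fun r' hr' => lt_of_lt_of_le (by linarith) (le_abs_self _))
  have hlower : y - δ ≤ upperMedian a L := by
    set large := (Finset.range (2 * L)).filter fun r => y - δ ≤ a r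
    have hsmall : ((Finset.range (2 * L)).filter fun r => ¬ y - δ ≤ a r).card < L :=
      hfew fun r hr => lt_of_lt_of_le (by linarith) (neg_le_abs _)
    have hlarge : L < large.card := by
      have hsplit : large.card + _ = (Finset.range (2 * L)).card :=
        Finset.card_filter_add_card_filter_not fun r => y - δ ≤ a r
      rw [Finset.card_range] at hsplit
      omega
    obtain ⟨r, hr, hmin⟩ := large.exists_min_image a (Finset.card_pos.1 (by omega))
    have hrank : L ≤ rank a L (a r) :=
      hlarge.le.trans (Finset.card_le_card fun r' hr' =>
        Finset.mem_filter.2 ⟨(Finset.mem_filter.1 hr').1, hmin r' hr'⟩)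
    have hr' := Finset.mem_filter.1 hr
    exact (Finset.le_fold_max _).2
      (Or.inr ⟨r, Finset.mem_filter.2 ⟨hr'.1, hrank⟩, hr'.2⟩)
  exact abs_sub_le_iff.2 ⟨by linarith, by linarith⟩

variable {E : Type w} [PseudoMetricSpace E] {n : ℕ} {M : Env.{u, v, w} E n} {R : ℝ}
  {z : Fin n → ℝ} {t : ℝ}

theorem measure_upperMedian_le (hM : M.Admissible R) (hz : ∀ j, 0 ≤ z j) (hz1 : ∑ j, z j ≤ 1)
    (ht : t ∈ Set.Ioc (0 : ℝ) 1) {ε : ℝ} (hε : 0 < ε) {N : ℕ} (hN : N ≠ 0)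
    (hbound : 16 * M.bound t ≤ N * ε ^ 2) (i : Fin n) :
    M.fam.tapeLaw {ω | ε * (M.kernelMatrix.mulVec (truncation z L) i + t) <
      |upperMedian (repetition M ω z L N · i) L - M.kernelMatrix.mulVec (truncation z L) i|} ≤
        (1 / 2) ^ (2 * L) := by
  classical
  set y := M.kernelMatrix.mulVec (truncation z L) i
  have hy : 0 ≤ y := hM.mulVec_nonneg (truncation_nonneg z L) i
  let bad (r : Fin (2 * L)) : Set (ℕ → M.fam.Fn × unitInterval) :=
    {ω | ε * (y + t) < |repetition M ω z L N r i - y|}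
  have hmeas : MeasurableSet {x : ℝ | ε * (y + t) < |x - y|} :=
    measurableSet_lt measurable_const (by fun_prop)
  have hbad (r : Fin (2 * L)) : MeasurableSet (bad r) := measurable_repetition r hmeas
  have hindep : iIndepSet bad M.fam.tapeLaw :=
    (iIndepSet_iff_meas_biInter hbad).2 fun s =>
      (iIndepFun_repetition (M := M) (z := z) (L := L) (N := N) (i := i)).meas_biInter
        fun r _ => ⟨_, hmeas, rfl⟩
  have hmajority := measure_card_le_two_mul_card_le hindep (p := 1 / 4)
    (ENNReal.div_le_of_le_mul (by norm_num))
    fun r => measure_repetition_le hM hz hz1 ht hε hN hbound r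
  refine (measure_mono fun ω hω => ?_).trans (hmajority.trans_eq ?_)
  · by_contra hgood
    refine not_le_of_gt hω (abs_upperMedian_sub_le hy (mul_pos hε (by linarith [ht.1])).le ?_)
    simp only [Set.mem_ofPred_eq, Fintype.card_fin, not_le] at hgood
    simp only [Finset.card_filter, Finset.sum_range] at hgood ⊢
    exact lt_of_mul_lt_mul_left hgood (by norm_num)
  · have hhalf : (2 : ENNReal) * (1 / 4) = 1 / 2 := by
      rw [ENNReal.eq_div_iff two_ne_zero ENNReal.ofNat_ne_top, ← mul_assoc]
      norm_num [ENNReal.mul_inv_cancel]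
    rw [Fintype.card_fin, hhalf]

end Median

section Accuracy

variable {E : Type w} [PseudoMetricSpace E] {n : ℕ} {M : Env.{u, v, w} E n} {R : ℝ}
  {z : Fin n → ℝ}

theorem mulVec_truncation_le (hM : M.Admissible R) (hz : ∀ j, 0 ≤ z j) (L : ℕ) (i : Fin n) :
    M.kernelMatrix.mulVec (truncation z L) i ≤ M.kernelMatrix.mulVec z i :=
  Finset.sum_le_sum (s := Finset.univ) fun j _ =>
    mul_le_mul_of_nonneg_left (truncation_le hz L j) (hM.ker_mem i j).1

theorem mulVec_le_truncation_add (hM : M.Admissible R) (hz : ∀ j, z j ≤ 1) (L : ℕ) (i : Fin n) :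
    M.kernelMatrix.mulVec z i ≤
      M.kernelMatrix.mulVec (truncation z (L + 1)) i + n * (1 / 2) ^ L := calc
  M.kernelMatrix.mulVec z i
      ≤ ∑ j : Fin n, (M.kernelMatrix i j * truncation z (L + 1) j + (1 / 2) ^ L) := by
        unfold Matrix.mulVec dotProduct
        refine Finset.sum_le_sum fun j _ => ?_
        have hker := hM.ker_mem i j
        calc M.kernelMatrix i j * z j
            ≤ M.kernelMatrix i j * (truncation z (L + 1) j + (1 / 2) ^ L) :=
              mul_le_mul_of_nonneg_left (le_truncation_add (hz j) L) hker.1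
          _ ≤ M.kernelMatrix i j * truncation z (L + 1) j + (1 / 2) ^ L := by
              rw [mul_add]
              gcongr
              exact mul_le_of_le_one_left (by positivity) hker.2
  _ = M.kernelMatrix.mulVec (truncation z (L + 1)) i + n * (1 / 2) ^ L := by
        rw [Finset.sum_add_distrib, Finset.sum_const, Finset.card_univ, Fintype.card_fin,
          nsmul_eq_mul]
        rfl

theorem abs_sub_mulVec_le (hM : M.Admissible R) (hz : ∀ j, z j ∈ Set.Icc (0 : ℝ) 1) {ε t : ℝ}
    (hε : ε ∈ Set.Icc (0 : ℝ) 1) (ht : 0 ≤ t) {L : ℕ} (hL : n * (1 / 2) ^ L ≤ t) {i : Fin n}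
    {x : ℝ} (hx : |x - M.kernelMatrix.mulVec (truncation z (L + 1)) i| ≤
      ε * (M.kernelMatrix.mulVec (truncation z (L + 1)) i + t)) :
    |x - M.kernelMatrix.mulVec z i| ≤ 2 * t + ε * |M.kernelMatrix.mulVec z i| := by
  set y := M.kernelMatrix.mulVec z i
  set y' := M.kernelMatrix.mulVec (truncation z (L + 1)) i
  have hlower : y' ≤ y := mulVec_truncation_le hM (fun j => (hz j).1) _ i
  have hupper : y ≤ y' + t :=
    (mulVec_le_truncation_add hM (fun j => (hz j).2) L i).trans (by gcongr)
  calc |x - y| ≤ |x - y'| + |y' - y| := abs_sub_le _ _ _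
    _ ≤ ε * (y' + t) + t := add_le_add hx (abs_sub_le_iff.2 ⟨by linarith, by linarith⟩)
    _ ≤ 1 * t + ε * |y| + t := by
        rw [mul_add, add_comm (ε * y')]
        gcongr
        exacts [hε.2, hε.1, hlower.trans (le_abs_self y)]
    _ = 2 * t + ε * |y| := by ring

theorem measure_exists_upperMedian_le (hM : M.Admissible R) (hz : ∀ j, 0 ≤ z j)
    (hz1 : ∑ j, z j ≤ 1) {t : ℝ} (ht : t ∈ Set.Ioc (0 : ℝ) 1) {ε : ℝ} (hε : 0 < ε) {L N : ℕ}
    (hL : n * (1 / 2) ^ L ≤ (1 : ℝ)) (hN : N ≠ 0) (hbound : 16 * M.bound t ≤ N * ε ^ 2) :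
    M.fam.tapeLaw {ω | ∃ i, ε * (M.kernelMatrix.mulVec (truncation z L) i + t) <
      |upperMedian (repetition M ω z L N · i) L - M.kernelMatrix.mulVec (truncation z L) i|} ≤
        (n : ENNReal)⁻¹ := by
  rw [Set.ofPred_exists]
  refine (measure_iUnion_fintype_le _ _).trans
    ((Finset.sum_le_sum fun i _ => measure_upperMedian_le hM hz hz1 ht hε hN hbound i).trans ?_)
  rw [Finset.sum_const, Finset.card_univ, Fintype.card_fin, nsmul_eq_mul,
    ENNReal.le_inv_iff_mul_le]
  have hL' : (n : ENNReal) * (1 / 2) ^ L ≤ 1 := by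
    rw [one_div, ← ENNReal.inv_pow, ← div_eq_mul_inv]
    refine ENNReal.div_le_of_le_mul ?_
    rw [one_mul]
    have hpow : (n : ℝ) ≤ 2 ^ L := by
      rwa [one_div, inv_pow, ← div_eq_mul_inv, div_le_one (by positivity)] at hL
    exact_mod_cast hpow
  calc (n : ENNReal) * (1 / 2) ^ (2 * L) * n = (n * (1 / 2) ^ L) ^ 2 := by ring
    _ ≤ 1 := pow_le_one₀ zero_le hL'

end Accuracy

section Norms

variable {n : ℕ} {p : ℝ}

theorem lpNorm_mono (hp : 0 ≤ p) {f g : Fin n → ℝ} (h : ∀ i, |f i| ≤ |g i|) :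
    lpNorm p f ≤ lpNorm p g :=
  Real.rpow_le_rpow (by positivity)
    (Finset.sum_le_sum fun i _ => Real.rpow_le_rpow (abs_nonneg _) (h i) hp) (by positivity)

theorem lpNorm_smul (hp : p ≠ 0) (c : ℝ) (g : Fin n → ℝ) :
    lpNorm p (c • g) = |c| * lpNorm p g := by
  simp only [lpNorm, Pi.smul_apply, smul_eq_mul, abs_mul, Real.mul_rpow (abs_nonneg _)
    (abs_nonneg _), ← Finset.mul_sum]
  rw [Real.mul_rpow (by positivity) (by positivity), ← Real.rpow_mul (abs_nonneg c),
    mul_one_div_cancel hp, Real.rpow_one]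

theorem lpNorm_const (hp : p ≠ 0) (c : ℝ) :
    lpNorm p (fun _ : Fin n => c) = |c| * (n : ℝ) ^ (1 / p) := by
  simp only [lpNorm, Finset.sum_const, Finset.card_univ, Fintype.card_fin, nsmul_eq_mul]
  rw [Real.mul_rpow (by positivity) (by positivity), ← Real.rpow_mul (abs_nonneg c),
    mul_one_div_cancel hp, Real.rpow_one, mul_comm]

theorem lpNorm_add_le (hp : 1 ≤ p) (f g : Fin n → ℝ) :
    lpNorm p (f + g) ≤ lpNorm p f + lpNorm p g :=
  Real.Lp_add_le Finset.univ f g hp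

theorem lpNorm_sub_le {a y : Fin n → ℝ} {ε c : ℝ} (hε : 0 ≤ ε) (hc : 0 ≤ c)
    (h : ∀ i, |a i - y i| ≤ ε * (c + |y i|)) (hp : 1 ≤ p) :
    lpNorm p (a - y) ≤ ε * (c * (n : ℝ) ^ (1 / p) + lpNorm p y) := by
  have hp0 : 0 < p := by linarith
  calc lpNorm p (a - y) ≤ lpNorm p (ε • ((fun _ => c) + fun i => |y i|)) :=
        lpNorm_mono hp0.le fun i => (h i).trans (le_abs_self _)
    _ = ε * lpNorm p ((fun _ => c) + fun i => |y i|) := by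
        rw [lpNorm_smul hp0.ne', abs_of_nonneg hε]
    _ ≤ ε * (lpNorm p (fun _ : Fin n => c) + lpNorm p fun i => |y i|) := by
        gcongr
        exact lpNorm_add_le hp _ _
    _ = ε * (c * (n : ℝ) ^ (1 / p) + lpNorm p y) := by
        rw [lpNorm_const hp0.ne', abs_of_nonneg hc]
        simp only [lpNorm, abs_abs]

end Norms

section Resources

variable {n : ℕ} {V : ℝ → ℝ} {ε τ t : ℝ}

theorem time_bound_le {L N T : ℕ} (hL : 0 < L) (hN : 0 < N) (hn : 0 < n) (hT : 0 < T) :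
    L * (n * 40 + 2 * L * (N * (n * (T + 40) + T * n + 40) + 40) + 110) + N * 40 +
        n * (2 * L * (2 * L * 40 + 70) + 40) + 20 + (n + 3) ≤
      800 * (L * L * N * (n * T)) := by
  obtain ⟨L, rfl⟩ := Nat.exists_eq_succ_of_ne_zero hL.ne'
  obtain ⟨N, rfl⟩ := Nat.exists_eq_succ_of_ne_zero hN.ne'
  obtain ⟨n, rfl⟩ := Nat.exists_eq_succ_of_ne_zero hn.ne'
  obtain ⟨T, rfl⟩ := Nat.exists_eq_succ_of_ne_zero hT.ne'
  simp only [Nat.succ_eq_add_one]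
  ring_nf
  omega

theorem depth_add_one_le (hn : 0 < n) (ht : t ∈ Set.Ioc (0 : ℝ) 1) :
    (depth n t + 1 : ℝ) ≤ 3 * Real.log (2 * n / t) := by
  have hn1 : (1 : ℝ) ≤ n := by exact_mod_cast hn
  have htwo : 2 ≤ 2 * n / t := by
    rw [le_div_iff₀ ht.1]
    linarith [ht.2]
  have hpow : (2 : ℝ) ^ depth n t ≤ 2 * n / t := by
    rcases hd : depth n t with _ | k
    · linarith
    · have hk : t < n * (1 / 2) ^ k := not_le.1 ((mul_half_pow_le_iff ht.1).not.2 (by omega))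
      rw [le_div_iff₀ ht.1]
      calc (2 : ℝ) ^ (k + 1) * t ≤ 2 ^ (k + 1) * (n * (1 / 2) ^ k) := by gcongr
        _ = 2 * n := by rw [pow_succ, one_div, inv_pow]; field_simp
  have hlog_two : Real.log 2 ≤ Real.log (2 * n / t) := Real.log_le_log two_pos htwo
  have hlog_pow : depth n t * Real.log 2 ≤ Real.log (2 * n / t) := by
    rw [← Real.log_pow]
    exact Real.log_le_log (by positivity) hpow
  nlinarith [Real.log_two_gt_d9, (depth n t).cast_nonneg (α := ℝ)]

theorem sampleSize_ne_zero (hε : 0 < ε) (hV : 0 ≤ V (ε * τ)) : sampleSize V ε τ ≠ 0 :=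
  (Nat.ceil_pos.2 (div_pos (by linarith) (mul_pos hε hε))).ne'

theorem bound_le_sampleSize (hε : 0 < ε) : 16 * V (ε * τ) ≤ sampleSize V ε τ * ε ^ 2 := by
  have hceil : 16 * (1 + V (ε * τ)) / (ε * ε) ≤ sampleSize V ε τ := Nat.le_ceil _
  rw [div_le_iff₀ (mul_pos hε hε)] at hceil
  rw [sq]
  linarith

theorem sampleSize_le (hε : ε ∈ Set.Ioc (0 : ℝ) 1) (hV : 0 ≤ V (ε * τ)) :
    (sampleSize V ε τ : ℝ) ≤ 33 * (1 / ε ^ 2 * max 1 (V (ε * τ))) := by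
  have hmax_one : 1 ≤ max 1 (V (ε * τ)) := le_max_left _ _
  have hmax_bound : V (ε * τ) ≤ max 1 (V (ε * τ)) := le_max_right _ _
  have hsq := pow_pos hε.1 2
  have hinv : 1 ≤ 1 / ε ^ 2 := one_le_one_div hsq (pow_le_one₀ hε.1.le hε.2)
  have hceil : (sampleSize V ε τ : ℝ) ≤ 16 * (1 + V (ε * τ)) / (ε * ε) + 1 :=
    (Nat.ceil_lt_add_one (div_nonneg (by linarith) (mul_self_nonneg ε))).le
  calc (sampleSize V ε τ : ℝ) ≤ 16 * (1 + V (ε * τ)) * (1 / ε ^ 2) + 1 := by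
        rwa [mul_one_div, sq]
    _ ≤ 16 * (max 1 (V (ε * τ)) + max 1 (V (ε * τ))) * (1 / ε ^ 2) +
        1 / ε ^ 2 * max 1 (V (ε * τ)) := by
        gcongr
        exact one_le_mul_of_one_le_of_one_le hinv hmax_one
    _ = 33 * (1 / ε ^ 2 * max 1 (V (ε * τ))) := by ring

theorem space_initState {E : Type w} (M : Env.{u, v, w} E n) (z : Fin n → ℝ) :
    (initState M z ε τ).space ≤ n + 3 := by
  have hunion := Finset.card_union_le ((Finset.range n).image fun i => (0, i))
    ({(1, 0), (1, 1)} : Finset (ℕ × ℕ))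
  have himage := Finset.card_image_le (s := Finset.range n) (f := fun i => (0, i))
  have hpair := Finset.card_le_two (a := ((1, 0) : ℕ × ℕ)) (b := (1, 1))
  rw [Finset.card_range] at himage
  simp only [State.space, initState, Finset.card_singleton, List.map_nil, List.sum_nil]
  omega

theorem exists_exec_program {E : Type w} (M : Env.{u, v, w} E n) (z : Fin n → ℝ) (hn : 0 < n)
    (hT : 1 ≤ M.cost) (hε : ε ∈ Set.Ioc (0 : ℝ) 1) (ht : ε * τ ∈ Set.Ioc (0 : ℝ) 1)
    (hV : 0 ≤ M.bound (ε * τ)) (ω : ℕ → M.fam.Fn × unitInterval) :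
    let L := depth n (ε * τ) + 1
    let N := sampleSize M.bound ε τ
    let B : ℝ := 237600 * Real.log (2 * n / (ε * τ)) ^ 2 *
      (1 / ε ^ 2 * max 1 (M.bound (ε * τ)) * (n * M.cost))
    ∃ s, Exec M ω program (initState M z ε τ) s ∧ s.time ≤ B ∧ s.space ≤ B ∧
      ∀ i, output s i = upperMedian (repetition M ω z L N · i) L := by
  intro L N B
  obtain ⟨s, hs, htime, hout⟩ := program_spec (M := M) (ω := ω) z ht.1
  have htotal : s.time + (n + 3) ≤ 800 * (L * L * N * (n * M.cost)) :=
    (Nat.add_le_add_right htime _).trans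
      (time_bound_le (Nat.succ_pos _) (sampleSize_ne_zero hε.1 hV).bot_lt hn hT)
  have hB : ((800 * (L * L * N * (n * M.cost)) : ℕ) : ℝ) ≤ B := by
    have hL : (L : ℝ) ≤ 3 * Real.log (2 * n / (ε * τ)) := by
      simpa only [L, Nat.cast_add, Nat.cast_one] using depth_add_one_le hn ht
    have hN : (N : ℝ) ≤ 33 * (1 / ε ^ 2 * max 1 (M.bound (ε * τ))) := sampleSize_le hε hV
    have hlog : 0 ≤ 3 * Real.log (2 * n / (ε * τ)) := (Nat.cast_nonneg L).trans hL
    push_cast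
    calc 800 * ((L : ℝ) * L * N * (n * M.cost))
        ≤ 800 * (3 * Real.log (2 * n / (ε * τ)) * (3 * Real.log (2 * n / (ε * τ))) *
          (33 * (1 / ε ^ 2 * max 1 (M.bound (ε * τ)))) * (n * M.cost)) := by gcongr
      _ = B := by simp only [B]; ring
  have hspace : s.space + (initState M z ε τ).time ≤ (initState M z ε τ).space + s.time :=
    hs.space_le
  have hinit := space_initState (ε := ε) (τ := τ) M z
  exact ⟨s, hs, le_trans (Nat.cast_le.2 (le_of_add_le_left htotal)) hB,
    le_trans (Nat.cast_le.2 (by lia)) hB, hout⟩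

end Resources
end HBE

universe u v w

open HBE MeasureTheory in
theorem theorem7p1_general :
    ∃ (prog : Cmd) (C : ℝ) (c : ℕ),
      ∀ {E : Type w} [PseudoMetricSpace E] {n : ℕ} {R : ℝ} (M : Env.{u, v, w} E n)
        (z : Fin n → ℝ) (ε τ : ℝ),
        0 < n →
        M.Admissible R →
        1 ≤ M.cost →
        (∀ i, 0 ≤ z i) →
        ∑ i, z i ≤ 1 →
        ε ∈ Set.Ioc (0 : ℝ) 1 →
        ε * τ ∈ Set.Ioc (0 : ℝ) 1 →
        let y : Fin n → ℝ := M.kernelMatrix.mulVec z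
        let B : ℝ := C * Real.log (2 * n / (ε * τ)) ^ c *
          (1 / ε ^ 2 * max 1 (M.bound (ε * τ)) * (n * M.cost))
        (∀ ω, ∃ s, Exec M ω prog (initState M z ε τ) s ∧
          (s.time : ℝ) ≤ B ∧ (s.space : ℝ) ≤ B) ∧
        M.fam.tapeLaw {ω | ¬ ∃ s, Exec M ω prog (initState M z ε τ) s ∧
          (∀ i, |output s i - y i| ≤ 3 * ε * τ + ε * |y i|) ∧
          (∀ p : ℝ, 1 ≤ p → lpNorm p (output s - y) ≤
            ε * (3 * τ * (n : ℝ) ^ (1 / p) + lpNorm p y))}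
          ≤ (n : ENNReal)⁻¹ := by
  refine ⟨program, 237600, 2, fun {_ _ n _} M z ε τ hn hM hT hz hz1 hε ht => ?_⟩
  intro y B
  have hτ : 0 < τ := pos_of_mul_pos_right ht.1 hε.1.le
  have hV : 0 ≤ M.bound (ε * τ) := hM.vBounded.nonneg _ ht
  have hdepth : n * (1 / 2) ^ depth n (ε * τ) ≤ ε * τ := (mul_half_pow_le_iff ht.1).2 le_rfl
  have hz01 (j) : z j ∈ Set.Icc (0 : ℝ) 1 :=
    ⟨hz j, (Finset.single_le_sum (fun i _ => hz i) (Finset.mem_univ j)).trans hz1⟩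
  have hrun := exists_exec_program M z hn hT hε ht hV
  refine ⟨fun ω => (hrun ω).imp fun _ h => ⟨h.1, h.2.1, h.2.2.1⟩, ?_⟩
  refine (measure_mono fun ω hfail => ?_).trans (measure_exists_upperMedian_le hM hz hz1 ht hε.1
    (((mul_half_pow_le_iff ht.1).2 (Nat.le_add_right _ 1)).trans ht.2) (sampleSize_ne_zero hε.1 hV)
    (bound_le_sampleSize hε.1))
  by_contra hgood
  simp only [Set.mem_ofPred_eq, not_exists, not_lt] at hgood
  obtain ⟨s, hs, -, -, hout⟩ := hrun ω
  have hpoint (i) : |output s i - y i| ≤ ε * (3 * τ + |y i|) := by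
    have hi := abs_sub_mulVec_le hM hz01 ⟨hε.1.le, hε.2⟩ ht.1.le hdepth (hgood i)
    rw [hout]
    linarith [ht.1]
  exact hfail ⟨s, hs, fun i => (hpoint i).trans_eq (by ring),
    fun _ hp => lpNorm_sub_le hε.1.le (by positivity) hpoint hp⟩

/-- One program, and one bound `B = C · log(2n/(ετ))^c · ε⁻² · V(ετ) · n · T` on time and space
(with `max 1 (V (ετ))` for `V (ετ)`), serve all hash families, kernels, datasets and weight
vectors. -/
theorem theorem7p1 :
    ∃ (prog : HBE.Cmd) (C : ℝ) (c : ℕ),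
      ∀ (d n : ℕ) (R : ℝ)
        (F : HBE.HashFamily (EuclideanSpace ℝ (Fin d)))
        (k : EuclideanSpace ℝ (Fin d) → EuclideanSpace ℝ (Fin d) → ℝ)
        (V : ℝ → ℝ) (T : ℕ)
        (x : Fin n → EuclideanSpace ℝ (Fin d)) (z : Fin n → ℝ) (ε τ : ℝ),
        (∀ a b, k a b ∈ Set.Icc (0 : ℝ) 1) →
        HBE.VBounded F k V R n →
        1 ≤ T →
        Function.Injective x →
        Metric.diam (Set.range x) ≤ R →
        (∀ i, 0 ≤ z i) →
        ∑ i, |z i| = 1 →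
        ε ∈ Set.Ioc (0 : ℝ) 1 →
        τ ∈ Set.Ioc (0 : ℝ) 1 →
        let M : HBE.Env (EuclideanSpace ℝ (Fin d)) n := ⟨F, k, V, T, x⟩
        let K : Matrix (Fin n) (Fin n) ℝ := Matrix.of fun i j => k (x i) (x j)
        let y : Fin n → ℝ := K.mulVec z
        let B : ℝ := C * Real.log (2 * n / (ε * τ)) ^ c *
          (1 / ε ^ 2 * max 1 (V (ε * τ)) * (n * T))
        (∀ ω, ∃ s, HBE.Exec M ω prog (HBE.initState M z ε τ) s ∧
          (s.time : ℝ) ≤ B ∧ (s.space : ℝ) ≤ B) ∧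
        F.tapeLaw {ω | ¬ ∃ s, HBE.Exec M ω prog (HBE.initState M z ε τ) s ∧
          (∀ i, |HBE.output s i - y i| ≤ 3 * ε * τ + ε * |y i|) ∧
          (∀ p : ℝ, 1 ≤ p → HBE.lpNorm p (HBE.output s - y) ≤
            ε * (3 * τ * (n : ℝ) ^ (1 / p) + HBE.lpNorm p y))}
          ≤ (n : ENNReal)⁻¹ := by
  obtain ⟨prog, C, c, h⟩ := theorem7p1_general
  refine ⟨prog, C, c, fun d n R F k V T x z ε τ hk hV hT hx hdiam hz hz1 hε hτ => ?_⟩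
  have hn : 0 < n := Nat.pos_of_ne_zero fun hn => by subst hn; simp at hz1
  have hsum : ∑ i, z i ≤ 1 := by simpa only [abs_of_nonneg (hz _)] using hz1.le
  exact h ⟨F, k, V, T, x⟩ z ε τ hn ⟨hV, fun _ _ => hk _ _, hx, hdiam⟩ hT hz hsum hε
    ⟨mul_pos hε.1 hτ.1, mul_le_one₀ hε.2 hτ.1.le hτ.2⟩
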